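/- Let $n\ge 3$, $m\ge 0$ be integers, let $\mathbb{D}^m\subset\mathbb{C}^m$ be a polydisc (with arbitrary centre and positive radii), and let $X=\mathbb{P}^{n-1}\times\mathbb{D}^m$, with homogeneous coordinates $y_0,\dots,y_{n-1}$ on $\mathbb{P}^{n-1}$ and coordinates $x_1,\dots,x_m$ on $\mathbb{D}^m$. Let $D_i=\{y_i=0\}\times\mathbb{D}^m$ and $\partial X=\bigcup_{i=0}^{n-1}D_i$ (the toric divisor). A log symplectic form on $X$ with polar divisor $\partial X$ is a closed meromorphic $2$-form $\omega$ on $X$, holomorphic on $X\setminus\partial X$ and with at most a first order pole along $\partial X$, such that $\dim X=n-1+m$ is even and $\omega^{(n-1+m)/2}$ is a meromorphic volume form with divisor exactly $-\partial X$ (a first order pole along $\partial X$, no other poles and no zeros). Its biresidues are the numbers $b_{ij}=\mathrm{res}_{D_j\cap D_i}\,\mathrm{res}_{D_i}\,\omega$ for $i\ne j$, and $b_{ii}=0$; here the residues are normalised so that $\frac{dz_i}{z_i}\wedge\frac{dz_j}{z_j}$ has $b_{ij}=1$. The form $\omega$ is semi-toric if $\mathrm{Lie}_{z_k\partial_{z_k}}\omega=0$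 for $k=1,\dots,n-1$, where $z_k=y_k/y_0$, and $\mathrm{Lie}_{\partial_{x_j}}\omega=0$ for $j=1,\dots,m$. Let $B=(b_{ij})_{i,j=0}^{n-1}$ be a skew-symmetric complex matrix whose rows sum to zero. Then there exists a log symplectic form $\omega$ on $X$ with polar divisor $\partial X$ and biresidues $(b_{ij})$ if and only if $n-1+m$ is even and $\mathrm{rank}(B)\ge n-1-m$. In that case, $\omega$ can be chosen to be semi-toric. -/

import Mathlib

open Filter Topology
open scoped LinearAlgebra.Projectivization

namespace LogSymp

noncomputable section

/-! ### The manifold `ℙⁿ⁻¹ × 𝔻ᵐ` and its toric divisor -/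

/-- Points of `ℙⁿ⁻¹ × ℂᵐ`; homogeneous coordinates on `ℙⁿ⁻¹` are indexed by `Fin n`. -/
abbrev Ambient (n m : ℕ) : Type := ℙ ℂ (Fin n → ℂ) × (Fin m → ℂ)

/-- The open polydisc in `ℂᵐ` with centre `c` and polyradius `r`. -/
def polydisc {m : ℕ} (c : Fin m → ℂ) (r : Fin m → ℝ) : Set (Fin m → ℂ) :=
  {x | ∀ j, ‖x j - c j‖ < r j}

/-- `X = ℙⁿ⁻¹ × 𝔻ᵐ`, where `𝔻ᵐ` is the polydisc with centre `c` and polyradius `r`. -/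
def X (n : ℕ) {m : ℕ} (c : Fin m → ℂ) (r : Fin m → ℝ) : Set (Ambient n m) :=
  {q | q.2 ∈ polydisc c r}

/-- `{yᵢ = 0} × ℂᵐ`, whose trace on `X` is the component `Dᵢ = Hᵢ × 𝔻ᵐ` of the toric divisor. -/
def coordDivisor {n m : ℕ} (i : Fin n) : Set (Ambient n m) := {q | q.1.rep i = 0}

/-- The (support of the) toric divisor `∂X = ⋃ᵢ Dᵢ`. -/
def toricDivisor (n m : ℕ) : Set (Ambient n m) := ⋃ i, coordDivisor i

/-! ### Affine charts -/

/-- Names of the affine coordinates on the chart `{yₐ ≠ 0}`: `inl k` is `z_k = y_k / yₐ` for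
`k ≠ a`, and `inr j` is the coordinate `x_j` of the polydisc. -/
abbrev Idx (n m : ℕ) (a : Fin n) : Type := {k : Fin n // k ≠ a} ⊕ Fin m

/-- The coordinate space `ℂⁿ⁻¹ × ℂᵐ` of the chart `{yₐ ≠ 0}`. -/
abbrev Coord (n m : ℕ) (a : Fin n) : Type := Idx n m a → ℂ

/-- The homogeneous coordinates (with `yₐ = 1`) of a point given in affine coordinates. -/
def homog {n m : ℕ} (a : Fin n) (p : Coord n m a) : Fin n → ℂ :=
  fun k => if h : k = a then 1 else p (Sum.inl ⟨k, h⟩)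

theorem homog_self {n m : ℕ} (a : Fin n) (p : Coord n m a) : homog a p a = 1 := by
  simp [homog]

theorem homog_of_ne {n m : ℕ} (a : Fin n) (p : Coord n m a) (k : {k : Fin n // k ≠ a}) :
    homog a p k = p (Sum.inl k) := by
  simp [homog, k.2]

theorem homog_ne_zero {n m : ℕ} (a : Fin n) (p : Coord n m a) : homog a p ≠ 0 := fun h => by
  have := congrFun h a
  simp [homog_self] at this

/-- The (inverse of the) affine chart: the point of `ℙⁿ⁻¹ × ℂᵐ` with given affine coordinates. -/
def chart {n m : ℕ} (a : Fin n) (p : Coord n m a) : Ambient n m :=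
  (Projectivization.mk ℂ (homog a p) (homog_ne_zero a p), fun j => p (Sum.inr j))

/-- The domain of the chart `{yₐ ≠ 0}` of `X`. -/
def dom {n m : ℕ} (c : Fin m → ℂ) (r : Fin m → ℝ) (a : Fin n) : Set (Coord n m a) :=
  {p | chart a p ∈ X n c r}

/-- The part of the chart domain that lies outside the toric divisor. -/
def reg {n m : ℕ} (c : Fin m → ℂ) (r : Fin m → ℝ) (a : Fin n) : Set (Coord n m a) :=
  {p | chart a p ∈ X n c r \ toricDivisor n m}

/-- The coordinate change from the chart `{yₐ ≠ 0}` to the chart `{y_b ≠ 0}`. -/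
def transition {n m : ℕ} (a b : Fin n) (p : Coord n m a) : Coord n m b
  | Sum.inl k => homog a p k / homog a p b
  | Sum.inr j => p (Sum.inr j)

theorem rep_mk_eq_zero_iff {n : ℕ} (v : Fin n → ℂ) (hv : v ≠ 0) (i : Fin n) :
    (Projectivization.mk ℂ v hv).rep i = 0 ↔ v i = 0 := by
  obtain ⟨u, hu⟩ := Projectivization.exists_smul_eq_mk_rep ℂ v hv
  rw [← hu]
  simp [Units.smul_def]

theorem chart_mem_coordDivisor {n m : ℕ} (a i : Fin n) (p : Coord n m a) :
    chart a p ∈ coordDivisor (m := m) i ↔ homog a p i = 0 :=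
  rep_mk_eq_zero_iff _ _ _

theorem mem_dom {n m : ℕ} (c : Fin m → ℂ) (r : Fin m → ℝ) (a : Fin n) (p : Coord n m a) :
    p ∈ dom c r a ↔ ∀ j, ‖p (Sum.inr j) - c j‖ < r j := Iff.rfl

theorem mem_reg {n m : ℕ} (c : Fin m → ℂ) (r : Fin m → ℝ) (a : Fin n) (p : Coord n m a) :
    p ∈ reg c r a ↔ p ∈ dom c r a ∧ ∀ k, p (Sum.inl k) ≠ 0 := by
  have h : chart a p ∈ toricDivisor n m ↔ ∃ k, p (Sum.inl k) = 0 := by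
    simp only [toricDivisor, Set.mem_iUnion, chart_mem_coordDivisor]
    constructor
    · rintro ⟨i, hi⟩
      have hia : i ≠ a := by
        rintro rfl
        simp [homog_self] at hi
      exact ⟨⟨i, hia⟩, (homog_of_ne a p ⟨i, hia⟩).symm.trans hi⟩
    · rintro ⟨k, hk⟩
      exact ⟨k, (homog_of_ne a p k).trans hk⟩
  change (p ∈ dom c r a ∧ ¬ _) ↔ _
  rw [h]
  simp

/-- The charts are injective. -/
theorem chart_injective {n m : ℕ} (a : Fin n) : Function.Injective (chart (m := m) a) := by
  intro p q h
  obtain ⟨h1, h2⟩ := Prod.mk.inj h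
  obtain ⟨u, hu⟩ := (Projectivization.mk_eq_mk_iff' ℂ _ _ _ _).1 h1
  have hu1 : u = 1 := by simpa [homog_self] using congrFun hu a
  funext s
  rcases s with k | j
  · rw [← homog_of_ne a p k, ← homog_of_ne a q k, ← hu, hu1, one_smul]
  · exact congrFun h2 j

/-- The chart with index `a` parametrizes `{yₐ ≠ 0}`. -/
theorem range_chart {n m : ℕ} (a : Fin n) :
    Set.range (chart (m := m) a) = (coordDivisor a)ᶜ := by
  ext q
  constructor
  · rintro ⟨p, rfl⟩ h
    rw [chart_mem_coordDivisor, homog_self] at h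
    exact one_ne_zero h
  · intro h
    have ha : q.1.rep a ≠ 0 := h
    refine ⟨Sum.elim (fun k : {k : Fin n // k ≠ a} => q.1.rep k / q.1.rep a) q.2, ?_⟩
    refine Prod.ext ?_ rfl
    rw [← Projectivization.mk_rep q.1]
    refine (Projectivization.mk_eq_mk_iff' ℂ _ _ _ _).2 ⟨(q.1.rep a)⁻¹, ?_⟩
    funext k
    by_cases hk : k = a
    · subst hk
      rw [homog_self]
      simp [ha]
    · simp [homog, hk, div_eq_inv_mul]

/-- `transition a b` is the coordinate change between the two charts. -/
theorem chart_transition {n m : ℕ} (a b : Fin n) (p : Coord n m a) (hb : homog a p b ≠ 0) :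
    chart b (transition a b p) = chart a p := by
  refine Prod.ext ?_ rfl
  refine (Projectivization.mk_eq_mk_iff' ℂ _ _ _ _).2 ⟨(homog a p b)⁻¹, ?_⟩
  funext k
  by_cases hk : k = b
  · subst hk
    rw [homog_self]
    simp [hb]
  · simp [homog_of_ne b _ ⟨k, hk⟩, transition, div_eq_inv_mul]

/-- The coordinate vector field with the given name, as a constant vector. -/
def ev {n m : ℕ} {a : Fin n} (s : Idx n m a) : Coord n m a := Pi.single s 1

/-- The reduced local equation `∏_{k ≠ a} z_k` of the toric divisor on the chart `{yₐ ≠ 0}`. -/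
def localEq {n m : ℕ} (a : Fin n) (p : Coord n m a) : ℂ :=
  ∏ k : {k : Fin n // k ≠ a}, p (Sum.inl k)

/-! ### Log symplectic forms -/

/-- A `2`-form on `X \ ∂X`, through its expressions in the affine charts, which are related by
pullback along the coordinate changes. Only the values of `expr a` on `reg c r a` matter. (No
regularity is imposed here; it is part of `IsLogSymplectic`.) -/
structure TwoForm (n : ℕ) {m : ℕ} (c : Fin m → ℂ) (r : Fin m → ℝ) where
  expr : ∀ a : Fin n, Coord n m a → Coord n m a [⋀^Fin 2]→L[ℂ] ℂ
  compat : ∀ a b : Fin n, ∀ p ∈ reg c r a,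
    expr a p = (expr b (transition a b p)).compContinuousLinearMap
      (fderiv ℂ (transition a b) p)

/-- The exterior power `ωᵏ = ω ∧ ⋯ ∧ ω` of an alternating `2`-form, evaluated on `2k` vectors
(indexed by `Fin k × Fin 2` in lexicographic order):
`ωᵏ(v₁, …, v₂ₖ) = 2⁻ᵏ ∑_σ sgn(σ) ∏ᵢ ω(v_{σ(2i-1)}, v_{σ(2i)})`. -/
def wedgePow {E : Type*} [NormedAddCommGroup E] [NormedSpace ℂ E]
    (ω : E [⋀^Fin 2]→L[ℂ] ℂ) (k : ℕ) (v : Fin k × Fin 2 → E) : ℂ :=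
  (2 ^ k : ℂ)⁻¹ * ∑ σ : Equiv.Perm (Fin k × Fin 2),
    ((Equiv.Perm.sign σ : ℤ) : ℂ) * ∏ i : Fin k, ω ![v (σ (i, 0)), v (σ (i, 1))]

/-- `ω` is a log symplectic form on `X` with polar divisor `∂X`: `dim X = n - 1 + m` is an even
number `2k`, `ω` is closed and meromorphic with at most a first order pole along `∂X` and no other
poles, and `ωᵏ` is a meromorphic volume form whose divisor is exactly `-∂X`.
In a chart with local equation `f = ∏ z_k` of `∂X` this means that `f ω` extends to a holomorphic
form, and that `f` times the coefficient of `ωᵏ` in the coordinate frame (enumerated in any order)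
extends to a nowhere vanishing holomorphic function. -/
structure IsLogSymplectic {n m : ℕ} {c : Fin m → ℂ} {r : Fin m → ℝ} (ω : TwoForm n c r) :
    Prop where
  closed : ∀ a, ∀ p ∈ reg c r a, extDeriv (ω.expr a) p = 0
  simplePole : ∀ a, ∃ g : Coord n m a → Coord n m a [⋀^Fin 2]→L[ℂ] ℂ,
    AnalyticOnNhd ℂ g (dom c r a) ∧ ∀ p ∈ reg c r a, localEq a p • ω.expr a p = g p
  pfaffian : ∃ k : ℕ, n - 1 + m = 2 * k ∧
    ∀ a, ∀ e : Fin k × Fin 2 ≃ Idx n m a, ∃ h : Coord n m a → ℂ,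
      AnalyticOnNhd ℂ h (dom c r a) ∧ (∀ p ∈ dom c r a, h p ≠ 0) ∧
      ∀ p ∈ reg c r a, localEq a p * wedgePow (ω.expr a p) k (fun t => ev (e t)) = h p

/-! ### Biresidues -/

/-- The part of `D_i` in the chart domain that lies on no other component of the divisor. -/
def regComp {n m : ℕ} (c : Fin m → ℂ) (r : Fin m → ℝ) (a : Fin n) (i : {k : Fin n // k ≠ a}) :
    Set (Coord n m a) :=
  {p | p ∈ dom c r a ∧ p (Sum.inl i) = 0 ∧ ∀ k, k ≠ i → p (Sum.inl k) ≠ 0}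

/-- In the chart `{yₐ ≠ 0}`, the `1`-form `α` is the residue `res_{D_i} ω`: if
`ω = dz_i/z_i ∧ α + β` near a point of `D_i`, with `α`, `β` regular there, then the restriction of
`α` to `D_i` is the limit of `z_i ω(∂_{z_i}, v)` at `D_i`, for `v` tangent to `D_i`. -/
def IsResidue {n m : ℕ} {c : Fin m → ℂ} {r : Fin m → ℝ} (ω : TwoForm n c r) (a : Fin n)
    (i : {k : Fin n // k ≠ a}) (α : Coord n m a → Coord n m a →L[ℂ] ℂ) : Prop :=
  ∀ p ∈ regComp c r a i, ∀ v : Coord n m a, v (Sum.inl i) = 0 →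
    Tendsto (fun q => q (Sum.inl i) * ω.expr a q ![ev (Sum.inl i), v])
      (𝓝[reg c r a] p) (𝓝 (α p v))

/-- `B` is the matrix of biresidues of `ω`: `b_{ij} = res_{D_j ∩ D_i} res_{D_i} ω` for `i ≠ j`, in
every chart and at every point that meets `D_i ∩ D_j`. The residue of the `1`-form `α = res_{D_i} ω`
on `D_i` along `D_j ∩ D_i` is the limit of `z_j α(∂_{z_j})`. -/
def HasBiresidues {n m : ℕ} {c : Fin m → ℂ} {r : Fin m → ℝ} (ω : TwoForm n c r)
    (B : Matrix (Fin n) (Fin n) ℂ) : Prop :=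
  ∀ (a : Fin n) (i j : {k : Fin n // k ≠ a}), i ≠ j →
    ∃ α : Coord n m a → Coord n m a →L[ℂ] ℂ, IsResidue ω a i α ∧
      ∀ p ∈ dom c r a, p (Sum.inl i) = 0 → p (Sum.inl j) = 0 →
        Tendsto (fun q => q (Sum.inl j) * α q (ev (Sum.inl j)))
          (𝓝[regComp c r a i] p) (𝓝 (B i j))

/-! ### Semi-toric forms -/

/-- The Lie derivative of a `2`-form along a vector field, on a normed space:
`(L_V ω)(u, v) = (D_V ω)(u, v) + ω(D_u V, v) + ω(u, D_v V)`. -/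
def lieDeriv {E : Type*} [NormedAddCommGroup E] [NormedSpace ℂ E] (V : E → E)
    (ω : E → E [⋀^Fin 2]→L[ℂ] ℂ) (p u v : E) : ℂ :=
  fderiv ℂ ω p (V p) ![u, v] + ω p ![fderiv ℂ V p u, v] + ω p ![u, fderiv ℂ V p v]

/-- `ω` is semi-toric: its Lie derivatives along all `z_k ∂_{z_k}` and all `∂_{x_j}` vanish. This is
asked in each affine chart; as `z_k ∂_{z_k}` is the vector field on `ℙⁿ⁻¹` induced by
`y_k ∂_{y_k}`, and these add up to `0`, any one chart gives the same condition. -/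
structure IsSemiToric {n m : ℕ} {c : Fin m → ℂ} {r : Fin m → ℝ} (ω : TwoForm n c r) : Prop where
  toric : ∀ (a : Fin n) (k : {k : Fin n // k ≠ a}), ∀ p ∈ reg c r a, ∀ u v,
    lieDeriv (fun q => q (Sum.inl k) • ev (Sum.inl k)) (ω.expr a) p u v = 0
  translation : ∀ (a : Fin n) (j : Fin m), ∀ p ∈ reg c r a, ∀ u v,
    lieDeriv (fun _ => ev (Sum.inr j)) (ω.expr a) p u v = 0

end

end LogSymp

/-! Everything is read in the logarithmic frame, where `z_k ∂_{z_k}` replaces `∂_{z_k}` and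
`∂_{x_j}` is kept. The local equation `f` is the product of the factors `z_k`, so `f` times the
coefficient of `ωᵏ` is, up to a constant, the Pfaffian of the matrix of `ω` in this frame.

Necessity. Closedness and the simple pole force the coefficient of `f ω` at `ds ∧ dt` to vanish on
every component other than `{s = 0}` and `{t = 0}` (`coeff_eq_zero`). Hence the logarithmic matrix
has a limit `L` at a point where all `z_k` vanish (`exists_tendsto_logMatrix`). The Pfaffian
condition makes `L` nonsingular, and its block in the `z` directions is `B` without row and column
`a`. The `n - 1` columns of `L` through this block are independent, and the `m` remaining rows
account for at most `m` of their rank, so `rank B ≥ n - 1 - m` (`rank_le_of_isLogSymplectic`).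

Sufficiency. A constant matrix `N` on `ℂⁿ ⊕ ℂᵐ` gives the form `½ ∑ N_{st} dlog s ∧ dlog t`. It
descends from homogeneous coordinates when the Euler vector `(1, …, 1, 0, …, 0)` lies in the kernel,
and is nondegenerate in each chart when the kernel is no larger. To extend `B` to such an `N`
(`exists_toricMatrix`), the kernel of `B` modulo constants, of dimension `d ≤ m`, is paired with `d`
of the coordinates `x_j`. The other `m - d` are even in number and carry a standard symplectic form.
-/

namespace LogSymp

/-! ### The Pfaffian sum -/

/-- The sum over permutations defining the top exterior power of a `2`-form with matrix `M`;
for skew-symmetric `M` it is `2 ^ k * k !` times the Pfaffian. -/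
def pfSum {k : ℕ} (M : Matrix (Fin k × Fin 2) (Fin k × Fin 2) ℂ) : ℂ :=
  ∑ σ : Equiv.Perm (Fin k × Fin 2),
    ((Equiv.Perm.sign σ : ℤ) : ℂ) * ∏ i : Fin k, M (σ (i, 0)) (σ (i, 1))

/-- The multilinear map `v ↦ ∏ᵢ M(v₍ᵢ,₀₎, v₍ᵢ,₁₎)`. -/
def pairProd {k : ℕ} (M : Matrix (Fin k × Fin 2) (Fin k × Fin 2) ℂ) :
    MultilinearMap ℂ (fun _ : Fin k × Fin 2 => Fin k × Fin 2 → ℂ) ℂ where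
  toFun v := ∏ i, (v (i, 0) ⬝ᵥ M.mulVec (v (i, 1)))
  map_update_add' := by
    rintro _ v ⟨i, e⟩ x y
    have key : ∀ z, ∏ j, (Function.update v (i, e) z (j, 0) ⬝ᵥ
          M.mulVec (Function.update v (i, e) z (j, 1)))
        = (Function.update v (i, e) z (i, 0) ⬝ᵥ M.mulVec (Function.update v (i, e) z (i, 1))) *
          ∏ j ∈ Finset.univ.erase i, (v (j, 0) ⬝ᵥ M.mulVec (v (j, 1))) := by
      intro z
      rw [← Finset.mul_prod_erase _ _ (Finset.mem_univ i)]
      congr 1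
      refine Finset.prod_congr rfl fun j hj => ?_
      have hj' : j ≠ i := Finset.ne_of_mem_erase hj
      simp [hj']
    rw [key, key, key, ← add_mul]
    congr 1
    fin_cases e <;> simp [Matrix.mulVec_add]
  map_update_smul' := by
    rintro _ v ⟨i, e⟩ t x
    have key : ∀ z, ∏ j, (Function.update v (i, e) z (j, 0) ⬝ᵥ
          M.mulVec (Function.update v (i, e) z (j, 1)))
        = (Function.update v (i, e) z (i, 0) ⬝ᵥ M.mulVec (Function.update v (i, e) z (i, 1))) *
          ∏ j ∈ Finset.univ.erase i, (v (j, 0) ⬝ᵥ M.mulVec (v (j, 1))) := by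
      intro z
      rw [← Finset.mul_prod_erase _ _ (Finset.mem_univ i)]
      congr 1
      refine Finset.prod_congr rfl fun j hj => ?_
      have hj' : j ≠ i := Finset.ne_of_mem_erase hj
      simp [hj']
    rw [key, key, smul_eq_mul, ← mul_assoc]
    congr 1
    fin_cases e <;> simp [Matrix.mulVec_smul]

theorem alternatization_pairProd {k : ℕ} (M : Matrix (Fin k × Fin 2) (Fin k × Fin 2) ℂ)
    (v : Fin k × Fin 2 → Fin k × Fin 2 → ℂ) :
    MultilinearMap.alternatization (pairProd M) v =
      pfSum (Matrix.of fun s t => v s ⬝ᵥ M.mulVec (v t)) := by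
  rw [MultilinearMap.alternatization_apply, pfSum]
  refine Finset.sum_congr rfl fun σ _ => ?_
  rw [Units.smul_def, zsmul_eq_mul]
  rfl

/-- As a function of `v` the left side is alternating in as many vectors as the dimension, hence a
multiple of the determinant. The standard basis gives the factor. -/
theorem pfSum_gram {k : ℕ} (M : Matrix (Fin k × Fin 2) (Fin k × Fin 2) ℂ)
    (v : Fin k × Fin 2 → Fin k × Fin 2 → ℂ) :
    pfSum (Matrix.of fun s t => v s ⬝ᵥ M.mulVec (v t)) = (Matrix.of v).det * pfSum M := by
  rw [← alternatization_pairProd M v,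
    (MultilinearMap.alternatization (pairProd M)).eq_smul_basis_det
      (Pi.basisFun ℂ (Fin k × Fin 2)), alternatization_pairProd]
  have h : (Matrix.of fun s t => (Pi.basisFun ℂ (Fin k × Fin 2)) s ⬝ᵥ
      M.mulVec ((Pi.basisFun ℂ (Fin k × Fin 2)) t)) = M := by
    ext s t
    simp
  rw [h, mul_comm]
  simp only [AlternatingMap.smul_apply, Pi.basisFun_det]
  rfl

theorem pfSum_transpose_mul_mul {k : ℕ} (M P : Matrix (Fin k × Fin 2) (Fin k × Fin 2) ℂ) :
    pfSum (P.transpose * M * P) = P.det * pfSum M := by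
  have h := pfSum_gram M fun s t => P t s
  have h1 : (Matrix.of fun s t : Fin k × Fin 2 => P t s) = P.transpose := rfl
  rw [h1, Matrix.det_transpose] at h
  rw [← h]
  congr 1
  ext s t
  rw [Matrix.mul_assoc, Matrix.mul_apply]
  rfl

/-- Congruence by a diagonal matrix. With logarithmic coefficients as the `d s`, the product becomes
the local equation of the divisor. -/
theorem pfSum_scale {k : ℕ} (M : Matrix (Fin k × Fin 2) (Fin k × Fin 2) ℂ)
    (d : Fin k × Fin 2 → ℂ) :
    pfSum (Matrix.of fun s t => d s * d t * M s t) = (∏ s, d s) * pfSum M := by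
  rw [← Matrix.det_diagonal, ← pfSum_transpose_mul_mul]
  congr 1
  ext s t
  simp [mul_comm, mul_left_comm]

theorem continuous_pfSum {k : ℕ} :
    Continuous (pfSum : Matrix (Fin k × Fin 2) (Fin k × Fin 2) ℂ → ℂ) := by
  unfold pfSum
  refine continuous_finsetSum _ fun σ _ => continuous_const.mul ?_
  exact continuous_finsetProd _ fun i _ => continuous_id.matrix_elem _ _

/-- A singular skew-symmetric matrix has vanishing Pfaffian. -/
theorem pfSum_eq_zero_of_mulVec {k : ℕ} {M : Matrix (Fin k × Fin 2) (Fin k × Fin 2) ℂ}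
    (hM : M.transpose = -M) {w : Fin k × Fin 2 → ℂ} (hw : w ≠ 0) (hMw : M.mulVec w = 0) :
    pfSum M = 0 := by
  obtain ⟨s, hs⟩ : ∃ s, w s ≠ 0 := by
    by_contra! h
    exact hw (funext h)
  -- Column `s` of `P` is the kernel vector, so row and column `s` of `Pᵀ M P` vanish, and each term
  -- of `pfSum` has a factor in one of them. By Cramer's rule `det P = w s`, which is nonzero.
  let P : Matrix (Fin k × Fin 2) (Fin k × Fin 2) ℂ := (1 : Matrix _ _ ℂ).updateCol s w
  have hdet : P.det = w s := by
    rw [← Matrix.cramer_apply]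
    simp
  have hcol : ∀ t, (P.transpose * M * P) t s = 0 := by
    intro t
    rw [Matrix.mul_assoc, Matrix.mul_apply]
    refine Finset.sum_eq_zero fun u _ => ?_
    have : (M * P) u s = M.mulVec w u := by
      simp [Matrix.mul_apply, Matrix.mulVec, dotProduct, P]
    rw [this, hMw]
    simp
  have hsk : (P.transpose * M * P).transpose = -(P.transpose * M * P) := by
    simp [Matrix.transpose_mul, hM, Matrix.mul_assoc]
  have hrow : ∀ t, (P.transpose * M * P) s t = 0 := by
    intro t
    have := congrFun (congrFun hsk t) s
    simp only [Matrix.transpose_apply, Matrix.neg_apply, hcol, neg_zero] at this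
    exact this
  have h0 : pfSum (P.transpose * M * P) = 0 := by
    refine Finset.sum_eq_zero fun σ _ => ?_
    obtain ⟨⟨i, e⟩, hi⟩ := σ.surjective s
    refine mul_eq_zero_of_right _ (Finset.prod_eq_zero (Finset.mem_univ i) ?_)
    obtain rfl | rfl : e = 0 ∨ e = 1 := by omega
    · rw [hi, hrow]
    · rw [hi, hcol]
  rw [pfSum_transpose_mul_mul, hdet] at h0
  exact (mul_eq_zero.1 h0).resolve_left hs

/-! ### Symplectic families -/

/-- The standard symplectic matrix, made of `2 × 2` blocks. -/
def stdJ (k : ℕ) : Matrix (Fin k × Fin 2) (Fin k × Fin 2) ℂ :=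
  Matrix.of fun s t => if s.1 = t.1 then (t.2 : ℕ) - (s.2 : ℕ) else 0

theorem stdJ_transpose (k : ℕ) : (stdJ k).transpose = -stdJ k := by
  ext s t
  by_cases h : s.1 = t.1
  · simp [stdJ, h]
  · simp [stdJ, h, Ne.symm h]

theorem stdJ_mulVec_zero {k : ℕ} (w : Fin k × Fin 2 → ℂ) (i : Fin k) :
    (stdJ k).mulVec w (i, 0) = w (i, 1) := by
  simp [stdJ, Matrix.mulVec, dotProduct, Fintype.sum_prod_type, Fin.sum_univ_two]

theorem stdJ_mulVec_one {k : ℕ} (w : Fin k × Fin 2 → ℂ) (i : Fin k) :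
    (stdJ k).mulVec w (i, 1) = -w (i, 0) := by
  simp [stdJ, Matrix.mulVec, dotProduct, Fintype.sum_prod_type, Fin.sum_univ_two]

theorem stdJ_mulVec_eq_zero {k : ℕ} {w : Fin k × Fin 2 → ℂ} (h : (stdJ k).mulVec w = 0) :
    w = 0 := by
  funext ⟨i, e⟩
  obtain rfl | rfl : e = 0 ∨ e = 1 := by omega
  · have := congrFun h (i, 1)
    rw [stdJ_mulVec_one] at this
    simpa using this
  · have := congrFun h (i, 0)
    rwa [stdJ_mulVec_zero] at this

/-- A nonzero term comes from a permutation that carries pairs to pairs: a permutation of the pairs,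
of sign `1` because it acts on both members alike, composed with permutations inside the pairs,
whose signs cancel the signs of the entries of `stdJ`. -/
theorem stdJ_term {k : ℕ} (σ : Equiv.Perm (Fin k × Fin 2)) :
    ((Equiv.Perm.sign σ : ℤ) : ℂ) * ∏ i : Fin k, stdJ k (σ (i, 0)) (σ (i, 1)) = 0 ∨
    ((Equiv.Perm.sign σ : ℤ) : ℂ) * ∏ i : Fin k, stdJ k (σ (i, 0)) (σ (i, 1)) = 1 := by
  by_cases h : ∃ i, stdJ k (σ (i, 0)) (σ (i, 1)) = 0
  · obtain ⟨i, hi⟩ := h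
    exact Or.inl (mul_eq_zero_of_right _ (Finset.prod_eq_zero (Finset.mem_univ i) hi))
  · right
    push Not at h
    have h1 : ∀ i, (σ (i, 0)).1 = (σ (i, 1)).1 := by
      intro i
      by_contra hne
      exact h i (by simp [stdJ, hne])
    have hτs : Function.Surjective fun i => (σ (i, 0)).1 := by
      intro j
      obtain ⟨⟨i, e⟩, hi⟩ := σ.surjective (j, 0)
      refine ⟨i, ?_⟩
      obtain rfl | rfl : e = 0 ∨ e = 1 := by omega
      · simp [hi]
      · simp [h1, hi]
    let τ : Equiv.Perm (Fin k) :=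
      Equiv.ofBijective _ ⟨Finite.injective_iff_surjective.2 hτs, hτs⟩
    have hfst : ∀ x, (σ x).1 = τ x.1 := by
      rintro ⟨i, e⟩
      obtain rfl | rfl : e = 0 ∨ e = 1 := by omega
      · rfl
      · exact (h1 i).symm
    have hsnd : ∀ i, Function.Injective fun e => (σ (i, e)).2 := by
      intro i e e' hee
      have : σ (i, e) = σ (i, e') := Prod.ext (by rw [hfst, hfst]) hee
      exact (Prod.mk.inj (σ.injective this)).2
    let ρ : Fin k → Equiv.Perm (Fin 2) := fun i =>
      Equiv.ofBijective _ ⟨hsnd i, Finite.injective_iff_surjective.1 (hsnd i)⟩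
    have hσ : σ = Equiv.prodCongrLeft (fun _ : Fin 2 => τ) * Equiv.prodCongrRight ρ := by
      ext1 ⟨i, e⟩
      exact Prod.ext (hfst (i, e)) rfl
    have hsign : Equiv.Perm.sign σ = ∏ i, Equiv.Perm.sign (ρ i) := by
      rw [hσ, Equiv.Perm.sign_mul, Equiv.Perm.sign_prodCongrLeft,
        Equiv.Perm.sign_prodCongrRight]
      simp
    rw [hsign]
    push_cast
    rw [← Finset.prod_mul_distrib]
    refine Finset.prod_eq_one fun i _ => ?_
    have hJ : stdJ k (σ (i, 0)) (σ (i, 1)) = ((ρ i 1 : ℕ) : ℂ) - ((ρ i 0 : ℕ) : ℂ) := by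
      simp only [stdJ, h1, Matrix.of_apply, if_true]
      rfl
    rw [hJ]
    have hfin : ∀ π : Equiv.Perm (Fin 2),
        ((Equiv.Perm.sign π : ℤ) * (((π 1 : ℕ) : ℤ) - ((π 0 : ℕ) : ℤ)) : ℤ) = 1 := by decide
    exact_mod_cast congrArg (Int.cast : ℤ → ℂ) (hfin (ρ i))

/-- No cancellation can occur among terms equal to `0` or `1`, and the identity contributes `1`. -/
theorem pfSum_stdJ_ne_zero (k : ℕ) : pfSum (stdJ k) ≠ 0 := by
  let T : Equiv.Perm (Fin k × Fin 2) → ℂ := fun σ =>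
    ((Equiv.Perm.sign σ : ℤ) : ℂ) * ∏ i : Fin k, stdJ k (σ (i, 0)) (σ (i, 1))
  have hT : ∀ σ, 0 ≤ (T σ).re := fun σ => by
    rcases stdJ_term σ with h | h <;> simp [T, h]
  have h1 : T 1 = 1 := by simp [T, stdJ]
  have hpos : 0 < (∑ σ, T σ).re := by
    rw [Complex.re_sum]
    exact Finset.sum_pos' (fun σ _ => hT σ) ⟨1, Finset.mem_univ _, by simp [h1]⟩
  intro h
  rw [show pfSum (stdJ k) = ∑ σ, T σ from rfl] at h
  rw [h] at hpos
  exact lt_irrefl _ hpos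

theorem skew_dotProduct {ι : Type*} [Fintype ι] {M : Matrix ι ι ℂ} (hM : M.transpose = -M)
    (x y : ι → ℂ) : x ⬝ᵥ M.mulVec y = -(y ⬝ᵥ M.mulVec x) := by
  rw [Matrix.dotProduct_mulVec, ← Matrix.mulVec_transpose, hM, Matrix.neg_mulVec,
    neg_dotProduct, dotProduct_comm]

theorem skew_dotProduct_self {ι : Type*} [Fintype ι] {M : Matrix ι ι ℂ}
    (hM : M.transpose = -M) (x : ι → ℂ) : x ⬝ᵥ M.mulVec x = 0 :=
  self_eq_neg.1 (skew_dotProduct hM x x)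

/-- A nonsingular skew-symmetric matrix admits a symplectic family of any possible length. -/
theorem exists_symplectic_family {ι : Type*} [Fintype ι] [DecidableEq ι] {M : Matrix ι ι ℂ}
    (hM : M.transpose = -M) (hinj : ∀ w, M.mulVec w = 0 → w = 0) (k : ℕ)
    (hk : 2 * k ≤ Fintype.card ι) :
    ∃ v : Fin k × Fin 2 → ι → ℂ, ∀ s t, v s ⬝ᵥ M.mulVec (v t) = stdJ k s t := by
  induction k with
  | zero => exact ⟨fun s => s.1.elim0, fun s => s.1.elim0⟩
  | succ k ih =>
    obtain ⟨v, hv⟩ := ih (by omega)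
    let φ : (ι → ℂ) →ₗ[ℂ] (Fin k × Fin 2 → ℂ) :=
      LinearMap.pi fun s => (dotProductBilin ℂ ℂ (v s)) ∘ₗ M.mulVecLin
    have hφ : ∀ x s, φ x s = v s ⬝ᵥ M.mulVec x := fun _ _ => rfl
    -- Orthogonality to the pairs already found imposes `2 k` conditions in dimension at least `2 k
    -- + 2`.
    obtain ⟨x, hxk, hx0⟩ : ∃ x, x ∈ LinearMap.ker φ ∧ x ≠ 0 := by
      refine (Submodule.ne_bot_iff _).1 (LinearMap.ker_ne_bot_of_finrank_lt ?_)
      simp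
      omega
    have hx : ∀ s, v s ⬝ᵥ M.mulVec x = 0 := fun s => by
      rw [← hφ, LinearMap.mem_ker.1 hxk]
      rfl
    obtain ⟨y₀, hy₀⟩ : ∃ y, x ⬝ᵥ M.mulVec y ≠ 0 := by
      by_contra! h
      refine hx0 (hinj x (dotProduct_eq_zero_iff.1 fun y => ?_))
      rw [dotProduct_comm, skew_dotProduct hM, h, neg_zero]
    let y₁ : ι → ℂ := (x ⬝ᵥ M.mulVec y₀)⁻¹ • y₀
    have hy₁ : x ⬝ᵥ M.mulVec y₁ = 1 := by
      simp [y₁, Matrix.mulVec_smul, hy₀]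
    -- Symplectic Gram–Schmidt: the component of `y₁` along the earlier pairs is removed. The value
    -- against `x` is unchanged, since `x` is orthogonal to them.
    let y : ι → ℂ := y₁ - ∑ i, ((v (i, 0) ⬝ᵥ M.mulVec y₁) • v (i, 1) -
      (v (i, 1) ⬝ᵥ M.mulVec y₁) • v (i, 0))
    have hxv : ∀ s, x ⬝ᵥ M.mulVec (v s) = 0 := fun s => by
      rw [skew_dotProduct hM, hx, neg_zero]
    have expand : ∀ z, z ⬝ᵥ M.mulVec y = z ⬝ᵥ M.mulVec y₁ -
        ∑ i, ((v (i, 0) ⬝ᵥ M.mulVec y₁) * (z ⬝ᵥ M.mulVec (v (i, 1))) -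
          (v (i, 1) ⬝ᵥ M.mulVec y₁) * (z ⬝ᵥ M.mulVec (v (i, 0)))) := by
      intro z
      simp only [y, Matrix.mulVec_sub, Matrix.mulVec_sum, dotProduct_sub, dotProduct_sum,
        Matrix.mulVec_smul, dotProduct_smul, smul_eq_mul]
    have hxy : x ⬝ᵥ M.mulVec y = 1 := by
      rw [expand]
      simp [hxv, hy₁]
    have hvy : ∀ s, v s ⬝ᵥ M.mulVec y = 0 := by
      rintro ⟨i, e⟩
      rw [expand]
      simp only [hv]
      obtain rfl | rfl : e = 0 ∨ e = 1 := by omega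
      · simp [stdJ]
      · simp [stdJ]
    refine ⟨fun s => Fin.cases (if s.2 = 0 then x else y) (fun i => v (i, s.2)) s.1, ?_⟩
    have hyx : y ⬝ᵥ M.mulVec x = -1 := by rw [skew_dotProduct hM, hxy]
    have hyv : ∀ s, y ⬝ᵥ M.mulVec (v s) = 0 := fun s => by
      rw [skew_dotProduct hM, hvy, neg_zero]
    rintro ⟨i, e⟩ ⟨j, e'⟩
    obtain rfl | ⟨i, rfl⟩ := Fin.eq_zero_or_eq_succ i <;>
      obtain rfl | ⟨j, rfl⟩ := Fin.eq_zero_or_eq_succ j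
    · obtain rfl | rfl : e = 0 ∨ e = 1 := by omega
      all_goals obtain rfl | rfl : e' = 0 ∨ e' = 1 := by omega
      all_goals simp [stdJ, hxy, hyx, skew_dotProduct_self hM]
    · obtain rfl | rfl : e = 0 ∨ e = 1 := by omega
      all_goals simp [stdJ, hxv, hyv, (Fin.succ_ne_zero j).symm]
    · obtain rfl | rfl : e' = 0 ∨ e' = 1 := by omega
      all_goals simp [stdJ, hx, hvy]
    · simpa [stdJ] using hv (i, e) (j, e')

/-- A nonsingular skew-symmetric matrix has nonzero Pfaffian. -/
theorem pfSum_ne_zero {k : ℕ} {M : Matrix (Fin k × Fin 2) (Fin k × Fin 2) ℂ}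
    (hM : M.transpose = -M) (hinj : ∀ w, M.mulVec w = 0 → w = 0) : pfSum M ≠ 0 := by
  -- With `k` pairs in dimension `2 k` the Gram matrix is `stdJ k`, and its `pfSum` is `det v` times
  -- that of `M`.
  obtain ⟨v, hv⟩ := exists_symplectic_family hM hinj k (by simp [mul_comm])
  intro h
  have := pfSum_gram M v
  rw [h, mul_zero, show (Matrix.of fun s t => v s ⬝ᵥ M.mulVec (v t)) = stdJ k from
    Matrix.ext hv] at this
  exact pfSum_stdJ_ne_zero k this

/-- A nonsingular skew-symmetric matrix has even size. -/
theorem even_card_of_skew {ι : Type*} [Fintype ι] [DecidableEq ι] {M : Matrix ι ι ℂ}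
    (hM : M.transpose = -M) (hinj : ∀ w, M.mulVec w = 0 → w = 0) : Even (Fintype.card ι) := by
  have hdet : M.det ≠ 0 := by
    intro h
    obtain ⟨w, hw, hMw⟩ := Matrix.exists_mulVec_eq_zero_iff.2 h
    exact hw (hinj w hMw)
  by_contra hodd
  have h := congrArg Matrix.det hM
  rw [Matrix.det_transpose, Matrix.det_neg, (Nat.not_even_iff_odd.1 hodd).neg_one_pow,
    neg_one_mul] at h
  exact hdet (self_eq_neg.1 h)

/-! ### Extending the biresidue matrix -/

/-- Linear functionals that detect the kernel of `B` modulo the constant vectors. -/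
theorem exists_dual_family {n : ℕ} (hn : 0 < n) {B : Matrix (Fin n) (Fin n) ℂ}
    (hrow : ∀ i, ∑ j, B i j = 0) :
    ∃ d : ℕ, d + 1 + B.rank ≤ n ∧ ∃ (A : Matrix (Fin d) (Fin n) ℂ) (w : Fin d → Fin n → ℂ),
      (∀ i, B.mulVec (w i) = 0) ∧ (∀ i, A.mulVec (w i) = Pi.single i 1) ∧
      (∀ i, ∑ j, A i j = 0) ∧
      ∀ u, B.mulVec u = 0 → A.mulVec u = 0 → ∃ t : ℂ, u = fun _ => t := by
  let one : Fin n → ℂ := fun _ => 1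
  have hone : one ≠ 0 := fun h => one_ne_zero (congrFun h ⟨0, hn⟩)
  let K : Submodule ℂ (Fin n → ℂ) := LinearMap.ker B.mulVecLin
  have hK1 : one ∈ K := by
    rw [LinearMap.mem_ker]
    funext i
    simpa [one, Matrix.mulVec, dotProduct] using hrow i
  let S : Submodule ℂ (Fin n → ℂ) := Submodule.span ℂ {one}
  -- The kernel of `B` modulo constants is the range of `f`. The vectors `w i` lift a basis of it,
  -- and the rows of `A` extend the dual basis to the whole quotient by constants, so they have zero
  -- sum.
  let f : K →ₗ[ℂ] ((Fin n → ℂ) ⧸ S) := S.mkQ.domRestrict K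
  let d := Module.finrank ℂ (LinearMap.range f)
  have hd : d + 1 + B.rank ≤ n := by
    have h1 := LinearMap.finrank_range_add_finrank_ker f
    have h2 := LinearMap.finrank_range_add_finrank_ker B.mulVecLin
    have h3 : 0 < Module.finrank ℂ (LinearMap.ker f) := by
      refine (Module.finrank_pos_iff_exists_ne_zero (R := ℂ) (M := LinearMap.ker f)).2
        ⟨(⟨⟨one, hK1⟩, ?_⟩ : LinearMap.ker f), ?_⟩
      · rw [LinearMap.mem_ker]
        exact (Submodule.Quotient.mk_eq_zero S).2 (Submodule.mem_span_singleton_self _)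
      · intro h
        exact hone (congrArg (fun z : LinearMap.ker f => ((z : K) : Fin n → ℂ)) h)
    have h4 : Module.finrank ℂ (Fin n → ℂ) = n := by simp
    have h5 : B.rank = Module.finrank ℂ (LinearMap.range B.mulVecLin) := rfl
    have h6 : Module.finrank ℂ K = Module.finrank ℂ (LinearMap.ker B.mulVecLin) := rfl
    omega
  let b : Module.Basis (Fin d) ℂ (LinearMap.range f) := Module.finBasis ℂ _
  choose w hw using fun i => (b i).2
  choose φ hφ using fun i => LinearMap.exists_extend (b.coord i)
  have hφ' : ∀ i (x : LinearMap.range f), φ i x = b.repr x i := fun i x => by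
    have := LinearMap.congr_fun (hφ i) x
    simpa using this
  let A : Matrix (Fin d) (Fin n) ℂ := Matrix.of fun i j => φ i (S.mkQ (Pi.single j 1))
  have hA : ∀ u i, A.mulVec u i = φ i (S.mkQ u) := by
    intro u i
    have := LinearMap.pi_apply_eq_sum_univ (φ i ∘ₗ S.mkQ) u
    rw [LinearMap.comp_apply] at this
    rw [this]
    simp only [Matrix.mulVec, dotProduct]
    refine Finset.sum_congr rfl fun j _ => ?_
    rw [smul_eq_mul, mul_comm]
    congr 1
    refine congrArg (fun z => φ i (S.mkQ z)) (funext fun l => ?_)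
    simp [Pi.single_apply, eq_comm]
  refine ⟨d, hd, A, fun i => (w i : Fin n → ℂ), fun i => ?_, fun i => ?_, fun i => ?_, ?_⟩
  · exact (w i).2
  · funext j
    have h1 : S.mkQ (w i : Fin n → ℂ) = b i := hw i
    rw [hA, h1, hφ', b.repr_self, Finsupp.single_eq_pi_single]
  · have h1 : S.mkQ one = 0 :=
      (Submodule.Quotient.mk_eq_zero S).2 (Submodule.mem_span_singleton_self _)
    have h2 := hA one i
    rw [h1, map_zero] at h2
    simpa [one, Matrix.mulVec, dotProduct] using h2
  · intro u hu hAu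
    have h1 : f ⟨u, hu⟩ = 0 := by
      have : (⟨f ⟨u, hu⟩, LinearMap.mem_range_self f _⟩ : LinearMap.range f) = 0 := by
        refine b.repr.map_eq_zero_iff.1 (Finsupp.ext fun i => ?_)
        rw [← hφ']
        exact (hA u i).symm.trans (congrFun hAu i)
      exact congrArg Subtype.val this
    obtain ⟨t, ht⟩ := Submodule.mem_span_singleton.1 ((Submodule.Quotient.mk_eq_zero S).1 h1)
    refine ⟨t, ht.symm.trans ?_⟩
    funext i
    simp [one]

/-- A skew-symmetric matrix on `ℂⁿ × ℂ^κ` whose kernel is spanned by `(1, …, 1, 0, …, 0)`. -/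
structure IsToricMatrix {n : ℕ} {κ : Type*} [Fintype κ]
    (N : Matrix (Fin n ⊕ κ) (Fin n ⊕ κ) ℂ) : Prop where
  skew : N.transpose = -N
  row_sum : ∀ s, ∑ j, N s (Sum.inl j) = 0
  ker : ∀ w, N.mulVec w = 0 → ∃ t : ℂ, w = Sum.elim (fun _ => t) 0

/-- The matrix has rows `(B, Aᵀ, 0)`, `(-A, 0, 0)`, `(0, 0, C)`. On a kernel vector `(u, y, z)` the
last two rows give `A u = 0` and `C z = 0`, and pairing the first with `w i ∈ ker B` isolates `y i`.
Then `u` lies in both kernels and is constant. -/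
theorem exists_toricMatrix_sum {n d : ℕ} {B : Matrix (Fin n) (Fin n) ℂ}
    (hskew : B.transpose = -B) (hrow : ∀ i, ∑ j, B i j = 0)
    {A : Matrix (Fin d) (Fin n) ℂ} {w : Fin d → Fin n → ℂ}
    (hBw : ∀ i, B.mulVec (w i) = 0) (hAw : ∀ i, A.mulVec (w i) = Pi.single i 1)
    (hA1 : ∀ i, ∑ j, A i j = 0)
    (hker : ∀ u, B.mulVec u = 0 → A.mulVec u = 0 → ∃ t : ℂ, u = fun _ => t)
    {κ : Type*} [Fintype κ] (C : Matrix κ κ ℂ)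
    (hC : C.transpose = -C) (hCinj : ∀ w, C.mulVec w = 0 → w = 0) :
    ∃ N : Matrix (Fin n ⊕ (Fin d ⊕ κ)) (Fin n ⊕ (Fin d ⊕ κ)) ℂ, IsToricMatrix N ∧
      ∀ i j, N (Sum.inl i) (Sum.inl j) = B i j := by
  let A' : Matrix (Fin d ⊕ κ) (Fin n) ℂ := Matrix.fromRows A 0
  let N : Matrix (Fin n ⊕ (Fin d ⊕ κ)) (Fin n ⊕ (Fin d ⊕ κ)) ℂ :=
    Matrix.fromBlocks B A'.transpose (-A') (Matrix.fromBlocks 0 0 0 C)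
  refine ⟨N, ⟨?_, ?_, ?_⟩, fun i j => rfl⟩
  · simp [N, Matrix.fromBlocks_transpose, Matrix.fromBlocks_neg, hskew, hC]
  · rintro (i | i | i)
    · exact hrow i
    · simpa [N, A'] using hA1 i
    · simp [N, A']
  · intro x hx
    obtain ⟨u, y, z, rfl⟩ : ∃ u y z, x = Sum.elim u (Sum.elim y z) :=
      ⟨fun i => x (Sum.inl i), fun i => x (Sum.inr (Sum.inl i)), fun i => x (Sum.inr (Sum.inr i)),
        by ext (i | i | i) <;> rfl⟩
    have hAy : A'.transpose.mulVec (Sum.elim y z) = A.transpose.mulVec y := by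
      ext i
      simp [Matrix.mulVec, dotProduct, A']
    have hA'u : A'.mulVec u = Sum.elim (A.mulVec u) 0 := by
      ext (i | i) <;> simp [Matrix.mulVec, dotProduct, A']
    simp only [N, Matrix.fromBlocks_mulVec, Sum.elim_comp_inl, Sum.elim_comp_inr, hAy,
      Matrix.neg_mulVec, hA'u, Matrix.zero_mulVec, zero_add, add_zero] at hx
    have h1 : B.mulVec u + A.transpose.mulVec y = 0 := by
      funext i
      exact congrFun hx (Sum.inl i)
    have h2 : A.mulVec u = 0 := by
      funext i
      have := congrFun hx (Sum.inr (Sum.inl i))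
      simpa using this
    have h3 : z = 0 := by
      refine hCinj z (funext fun i => ?_)
      have := congrFun hx (Sum.inr (Sum.inr i))
      simpa using this
    have h4 : y = 0 := by
      funext i
      have := congrArg (fun v => w i ⬝ᵥ v) h1
      simp only [dotProduct_add, dotProduct_zero] at this
      rw [skew_dotProduct hskew, hBw, dotProduct_zero, neg_zero, zero_add,
        Matrix.dotProduct_mulVec, Matrix.vecMul_transpose, hAw, single_one_dotProduct] at this
      exact this
    have h5 : B.mulVec u = 0 := by
      simpa [h4] using h1
    obtain ⟨t, rfl⟩ := hker u h5 h2
    refine ⟨t, ?_⟩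
    rw [h3, h4]
    ext (i | i | i) <;> rfl

/-- The inclusion of the coordinates of an affine chart into all the logarithmic coordinates. -/
def incl {n : ℕ} {κ : Type*} (a : Fin n) : {k : Fin n // k ≠ a} ⊕ κ → Fin n ⊕ κ :=
  Sum.map Subtype.val id

theorem sum_incl {n : ℕ} {κ : Type*} [Fintype κ] (a : Fin n) (F : Fin n ⊕ κ → ℂ)
    (hF : F (Sum.inl a) = 0) : ∑ s, F (incl a s) = ∑ s, F s := by
  rw [Fintype.sum_sum_type, Fintype.sum_sum_type]
  congr 1
  have := Fintype.sum_subtype_add_sum_subtype (fun k => k ≠ a) fun k => F (Sum.inl k)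
  rw [← this]
  simp only [incl, Sum.map_inl]
  symm
  rw [add_eq_left]
  refine Finset.sum_eq_zero fun k _ => ?_
  rw [not_not.1 k.2, hF]

/-- Extend `w` by zero at `a`. The image under `N` vanishes outside row `a`, and then also there,
because by skewness the homogeneous rows of `N` sum to zero. So the extension is a multiple of the
Euler vector that is zero at `a`. -/
theorem IsToricMatrix.minor_injective {n : ℕ} {κ : Type*} [Fintype κ]
    {N : Matrix (Fin n ⊕ κ) (Fin n ⊕ κ) ℂ} (hN : IsToricMatrix N) (a : Fin n)
    (w : {k : Fin n // k ≠ a} ⊕ κ → ℂ) (hw : (N.submatrix (incl a) (incl a)).mulVec w = 0) :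
    w = 0 := by
  let W : Fin n ⊕ κ → ℂ :=
    Sum.elim (fun k => if h : k = a then 0 else w (Sum.inl ⟨k, h⟩)) fun j => w (Sum.inr j)
  have hWa : W (Sum.inl a) = 0 := by simp [W]
  have hW : ∀ s, W (incl a s) = w s := by
    rintro (⟨k, hk⟩ | j)
    · simp [W, incl, hk]
    · rfl
  have h1 : ∀ s, N.mulVec W (incl a s) = 0 := by
    intro s
    rw [← show _ = (0 : ℂ) from congrFun hw s]
    simp only [Matrix.mulVec, dotProduct]
    rw [← sum_incl a _ (by rw [hWa, mul_zero])]
    exact Finset.sum_congr rfl fun t _ => by rw [hW]; rfl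
  have h2 : N.mulVec W = 0 := by
    have hk : ∀ k, k ≠ a → N.mulVec W (Sum.inl k) = 0 := fun k hk => h1 (Sum.inl ⟨k, hk⟩)
    have hsum : ∑ k, N.mulVec W (Sum.inl k) = 0 := by
      simp only [Matrix.mulVec, dotProduct]
      rw [Finset.sum_comm]
      refine Finset.sum_eq_zero fun s _ => ?_
      rw [← Finset.sum_mul]
      have : ∑ k, N (Sum.inl k) s = -∑ k, N s (Sum.inl k) := by
        rw [← Finset.sum_neg_distrib]
        exact Finset.sum_congr rfl fun k _ => congrFun (congrFun hN.skew s) (Sum.inl k)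
      rw [this, hN.row_sum, neg_zero, zero_mul]
    rw [Fintype.sum_eq_single a hk] at hsum
    funext s
    rcases s with k | j
    · by_cases h : k = a
      · rw [h]; exact hsum
      · exact hk k h
    · exact h1 (Sum.inr j)
  obtain ⟨t, ht⟩ := hN.ker W h2
  have ht0 : t = 0 := by
    rw [← hWa, ht]
    rfl
  funext s
  rw [← hW, ht, ht0]
  rcases incl a s with k | j <;> rfl

theorem IsToricMatrix.even {n : ℕ} {κ : Type*} [Fintype κ] [DecidableEq κ]
    {N : Matrix (Fin n ⊕ κ) (Fin n ⊕ κ) ℂ} (hN : IsToricMatrix N) (a : Fin n) :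
    Even (n - 1 + Fintype.card κ) := by
  have h := even_card_of_skew (M := N.submatrix (incl a) (incl a))
    (by rw [Matrix.transpose_submatrix, hN.skew]; rfl) (hN.minor_injective a)
  rwa [Fintype.card_sum, Fintype.card_subtype_compl, Fintype.card_fin,
    Fintype.card_subtype_eq] at h

theorem IsToricMatrix.reindex {n : ℕ} {κ κ' : Type*} [Fintype κ] [Fintype κ']
    {N : Matrix (Fin n ⊕ κ) (Fin n ⊕ κ) ℂ} (hN : IsToricMatrix N) (e : κ' ≃ κ) :
    IsToricMatrix (N.submatrix (Sum.map id e) (Sum.map id e)) where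
  skew := by rw [Matrix.transpose_submatrix, hN.skew]; rfl
  row_sum s := hN.row_sum _
  ker w hw := by
    let E : Fin n ⊕ κ' ≃ Fin n ⊕ κ := Equiv.sumCongr (Equiv.refl _) e
    have h : (N.submatrix E E).mulVec w = 0 := hw
    rw [Matrix.submatrix_mulVec_equiv] at h
    obtain ⟨t, ht⟩ := hN.ker (w ∘ E.symm) (funext fun s => by
      have := congrFun h (E.symm s)
      simpa using this)
    refine ⟨t, funext fun s => ?_⟩
    have := congrFun ht (E s)
    simp only [Function.comp_apply, Equiv.symm_apply_apply] at this
    rw [this]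
    rcases s with s | s <;> rfl

theorem exists_toricMatrix {n m : ℕ} (hn : 0 < n) {B : Matrix (Fin n) (Fin n) ℂ}
    (hskew : B.transpose = -B) (hrow : ∀ i, ∑ j, B i j = 0) (heven : Even (n - 1 + m))
    (hrank : (n : ℤ) - 1 - m ≤ B.rank) :
    ∃ N : Matrix (Fin n ⊕ Fin m) (Fin n ⊕ Fin m) ℂ, IsToricMatrix N ∧
      ∀ i j, N (Sum.inl i) (Sum.inl j) = B i j := by
  obtain ⟨d, hd, A, w, hBw, hAw, hA1, hker⟩ := exists_dual_family hn hrow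
  -- The extension with empty `C` serves only for parity: its minors are nonsingular and skew of
  -- size `n - 1 + d`.
  have hde : Even (n - 1 + d) := by
    obtain ⟨N, hN, -⟩ := exists_toricMatrix_sum hskew hrow hBw hAw hA1 hker
      (0 : Matrix (Fin 0) (Fin 0) ℂ) (by ext i; exact i.elim0) fun w _ => funext fun i => i.elim0
    simpa using hN.even ⟨0, hn⟩
  obtain ⟨e, he⟩ : ∃ e, m = d + e * 2 := by
    obtain ⟨p, hp⟩ := heven
    obtain ⟨q, hq⟩ := hde
    -- The subtraction is not truncated: `hd` and `hrank` give `d ≤ n - 1 - rank B ≤ m`.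
    exact ⟨p - q, by omega⟩
  obtain ⟨N, hN, hNB⟩ := exists_toricMatrix_sum hskew hrow hBw hAw hA1 hker (stdJ e)
    (stdJ_transpose e) fun w => stdJ_mulVec_eq_zero
  let E : Fin m ≃ Fin d ⊕ (Fin e × Fin 2) := Fintype.equivOfCardEq (by simp [he])
  exact ⟨_, hN.reindex E, hNB⟩

/-! ### Analytic functions vanishing on coordinate hyperplanes -/

/-- An analytic function vanishing on the coordinate hyperplanes `{q i = 0}`, `i ∈ S`, is a constant
multiple of `∏ i ∈ S, q i` near a point of their intersection, up to an error of relative size `ε`. -/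
theorem exists_norm_sub_prod_le {ι : Type*} [Fintype ι] [DecidableEq ι] {U : Set (ι → ℂ)}
    (hU : IsOpen U) {O : ι → ℂ} (hO : O ∈ U) (S : Finset ι) (hS : ∀ i ∈ S, O i = 0) :
    ∀ F : (ι → ℂ) → ℂ, AnalyticOnNhd ℂ F U → (∀ i ∈ S, ∀ p ∈ U, p i = 0 → F p = 0) →
      ∃ C : ℂ, ∀ ε > 0, ∃ δ > 0, ∀ q ∈ Metric.ball O δ,
        ‖F q - C * ∏ i ∈ S, q i‖ ≤ ε * ∏ i ∈ S, ‖q i‖ := by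
  induction S using Finset.induction_on with
  | empty =>
    intro F hF _
    refine ⟨F O, fun ε hε => ?_⟩
    obtain ⟨δ, hδ, h⟩ := Metric.continuousAt_iff.1 (hF O hO).continuousAt ε hε
    refine ⟨δ, hδ, fun q hq => ?_⟩
    simpa [dist_eq_norm] using (h hq).le
  | insert i S hi ih =>
    intro F hF hFS
    have hder : ∀ p ∈ U, HasFDerivAt F (fderiv ℂ F p) p := fun p hp =>
      (hF p hp).differentiableAt.hasFDerivAt
    have hupd : ∀ (q : ι → ℂ) (t : ℂ), Function.update q i t ∈ U →
        HasDerivAt (fun t => F (Function.update q i t))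
          (fderiv ℂ F (Function.update q i t) (Pi.single i 1)) t := fun q t ht =>
      (hder _ ht).comp_hasDerivAt t (hasDerivAt_update q i t)
    -- The induction hypothesis applies to `∂ᵢF`: it still vanishes on the hyperplanes indexed by
    -- `S`, since moving the coordinate `i` stays inside them.
    obtain ⟨C, hC⟩ := ih (fun j hj => hS j (Finset.mem_insert_of_mem hj))
      (fun p => fderiv ℂ F p (Pi.single i 1))
      (fun p hp => ((ContinuousLinearMap.apply ℂ ℂ (Pi.single i (1 : ℂ) : ι → ℂ)).analyticAt
        _).comp (hF.fderiv p hp)) (by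
        intro j hj p hp hpj
        have hji : j ≠ i := fun h => hi (h ▸ hj)
        have h1 := hupd p (p i) (by rwa [Function.update_eq_self])
        rw [Function.update_eq_self] at h1
        have hcont : ContinuousAt (fun t => Function.update p i t) (p i) :=
          (hasDerivAt_update p i (p i)).continuousAt
        have h2 : (fun t => F (Function.update p i t)) =ᶠ[𝓝 (p i)] fun _ => 0 := by
          have : ∀ᶠ t in 𝓝 (p i), Function.update p i t ∈ U :=
            hcont.eventually_mem (by
              rw [Function.update_eq_self]
              exact hU.mem_nhds hp)
          filter_upwards [this] with t ht
          exact hFS j (Finset.mem_insert_of_mem hj) _ ht (by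
            rw [Function.update_of_ne hji, hpj])
        exact h1.unique ((hasDerivAt_const (p i) (0 : ℂ)).congr_of_eventuallyEq h2))
    refine ⟨C, fun ε hε => ?_⟩
    obtain ⟨δ₁, hδ₁, h⟩ := hC ε hε
    obtain ⟨δ₂, hδ₂, hball⟩ := Metric.isOpen_iff.1 hU O hO
    refine ⟨min δ₁ δ₂, lt_min hδ₁ hδ₂, fun q hq => ?_⟩
    have hOi : O i = 0 := hS i (Finset.mem_insert_self _ _)
    have hqi : ∀ t : ℂ, t ∈ Metric.ball (0 : ℂ) (min δ₁ δ₂) →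
        Function.update q i t ∈ Metric.ball O (min δ₁ δ₂) := by
      intro t ht
      rw [Metric.mem_ball, dist_pi_lt_iff (lt_min hδ₁ hδ₂)] at hq ⊢
      intro j
      by_cases hj : j = i
      · subst hj
        rw [Function.update_self, hOi]
        exact ht
      · rw [Function.update_of_ne hj]
        exact hq j
    have hprod : ∀ t : ℂ, ∏ j ∈ S, Function.update q i t j = ∏ j ∈ S, q j := fun t =>
      Finset.prod_congr rfl fun j hj => Function.update_of_ne (ne_of_mem_of_not_mem hj hi) _ _
    have hprod' : ∀ t : ℂ, ∏ j ∈ S, ‖Function.update q i t j‖ = ∏ j ∈ S, ‖q j‖ := fun t =>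
      Finset.prod_congr rfl fun j hj => by
        rw [Function.update_of_ne (ne_of_mem_of_not_mem hj hi)]
    -- The estimate of `∂ᵢF` is integrated by the mean value inequality from `0` to `q i`, starting
    -- on the hyperplane where `F` vanishes.
    have hmv := (convex_ball (0 : ℂ) (min δ₁ δ₂)).norm_image_sub_le_of_norm_hasDerivWithin_le
      (f := fun t => F (Function.update q i t) - t * (C * ∏ j ∈ S, q j))
      (f' := fun t => fderiv ℂ F (Function.update q i t) (Pi.single i 1) - 1 * (C * ∏ j ∈ S, q j))
      (C := ε * ∏ j ∈ S, ‖q j‖) (x := 0) (y := q i)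
      (fun t ht => ((hupd q t (hball (Metric.ball_subset_ball (min_le_right _ _)
        (hqi t ht)))).sub ((hasDerivAt_id t).mul_const _)).hasDerivWithinAt)
      (fun t ht => by
        have := h _ (Metric.ball_subset_ball (min_le_left _ _) (hqi t ht))
        rwa [hprod, hprod', ← one_mul (C * _)] at this)
      (by simp [hδ₁, hδ₂])
      (by
        rw [Metric.mem_ball, dist_pi_lt_iff (lt_min hδ₁ hδ₂)] at hq
        simpa [hOi] using hq i)
    have h0 : F (Function.update q i 0) = 0 := by
      refine hFS i (Finset.mem_insert_self _ _) _ (hball (Metric.ball_subset_ball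
        (min_le_right _ _) (hqi 0 ?_))) (Function.update_self _ _ _)
      simp [hδ₁, hδ₂]
    rw [Function.update_eq_self, h0] at hmv
    rw [Finset.prod_insert hi, Finset.prod_insert hi]
    calc _ = ‖F q - q i * (C * ∏ j ∈ S, q j) - (0 - 0 * (C * ∏ j ∈ S, q j))‖ := by
          congr 1; ring
      _ ≤ _ := hmv
      _ = _ := by rw [sub_zero]; ring

/-- This stands in for dividing `F` by a monomial: only the limit of the quotient at `O`, taken off
the hyperplanes, is needed. -/
theorem exists_tendsto_div_prod {ι : Type*} [Fintype ι] [DecidableEq ι] {U : Set (ι → ℂ)}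
    (hU : IsOpen U) {O : ι → ℂ} (hO : O ∈ U) (S : Finset ι) (hS : ∀ i ∈ S, O i = 0)
    {F : (ι → ℂ) → ℂ} (hF : AnalyticOnNhd ℂ F U) (hFS : ∀ i ∈ S, ∀ p ∈ U, p i = 0 → F p = 0)
    {R : Set (ι → ℂ)} (hR : ∀ q ∈ R, ∀ i ∈ S, q i ≠ 0) :
    ∃ C : ℂ, Tendsto (fun q => F q / ∏ i ∈ S, q i) (𝓝[R] O) (𝓝 C) := by
  obtain ⟨C, hC⟩ := exists_norm_sub_prod_le hU hO S hS F hF hFS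
  refine ⟨C, Metric.nhds_basis_closedBall.tendsto_right_iff.2 fun ε hε => ?_⟩
  obtain ⟨δ, hδ, h⟩ := hC ε hε
  filter_upwards [self_mem_nhdsWithin, mem_nhdsWithin_of_mem_nhds (Metric.ball_mem_nhds O hδ)]
    with q hqR hq
  have h0 : ∏ i ∈ S, q i ≠ 0 := Finset.prod_ne_zero_iff.2 (hR q hqR)
  rw [mem_closedBall_iff_norm, div_sub' h0, norm_div, norm_prod,
    div_le_iff₀ (by rw [← norm_prod]; exact norm_pos_iff.2 h0), mul_comm (∏ i ∈ S, q i)]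
  exact h q hq

/-- An iterated limit agrees with the joint limit. -/
theorem eq_of_tendsto_iterated {E : Type*} [TopologicalSpace E] {φ m : E → ℂ} {R S : Set E} {O : E}
    {L b : ℂ} (hφ : Tendsto φ (𝓝[R] O) (𝓝 L)) (hm : ∀ p ∈ S, Tendsto φ (𝓝[R] p) (𝓝 (m p)))
    (hR : ∀ p ∈ S, (𝓝[R] p).NeBot) [(𝓝[S] O).NeBot] (hb : Tendsto m (𝓝[S] O) (𝓝 b)) : b = L := by
  refine tendsto_nhds_unique hb ((closed_nhds_basis L).tendsto_right_iff.2 ?_)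
  rintro V ⟨hV, hVc⟩
  obtain ⟨U, hUV, hU, hOU⟩ := eventually_nhds_iff.1
    (eventually_nhdsWithin_iff.1 (hφ.eventually_mem hV))
  filter_upwards [self_mem_nhdsWithin, mem_nhdsWithin_of_mem_nhds (hU.mem_nhds hOU)] with p hpS hpU
  have := hR p hpS
  refine hVc.mem_of_tendsto (hm p hpS) ?_
  filter_upwards [self_mem_nhdsWithin, mem_nhdsWithin_of_mem_nhds (hU.mem_nhds hpU)] with q hqR hqU
  exact hUV q hqU hqR

/-! ### Chart domains -/

section Charts

variable {n m : ℕ} {c : Fin m → ℂ} {r : Fin m → ℝ} {a : Fin n}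

theorem isOpen_dom : IsOpen (dom c r a) := by
  have : dom c r a = ⋂ j, {p | ‖p (Sum.inr j) - c j‖ < r j} := by
    ext p
    simp [mem_dom]
  rw [this]
  exact isOpen_iInter_of_finite fun j => isOpen_lt (by fun_prop) continuous_const

theorem isOpen_reg : IsOpen (reg c r a) := by
  have : reg c r a = dom c r a ∩ ⋂ k, {p | p (Sum.inl k) ≠ 0} := by
    ext p
    simp [mem_reg]
  rw [this]
  exact isOpen_dom.inter (isOpen_iInter_of_finite fun j =>
    isOpen_ne_fun (by fun_prop) continuous_const)

theorem reg_subset_dom : reg c r a ⊆ dom c r a := fun p hp => ((mem_reg c r a p).1 hp).1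

/-- A point of the chart domain can be approached by moving the coordinates in `P` off zero. -/
theorem neBot_nhdsWithin_ne_zero {p : Coord n m a} (hp : p ∈ dom c r a)
    (P : {k : Fin n // k ≠ a} → Prop) :
    (𝓝[{q | q ∈ dom c r a ∧ (∀ k, P k → q (Sum.inl k) ≠ 0) ∧
      ∀ k, ¬ P k → q (Sum.inl k) = p (Sum.inl k)}] p).NeBot := by
  classical
  let γ : ℂ → Coord n m a := fun t =>
    p + t • Sum.elim (fun k => if P k then 1 else 0) fun _ => 0
  have hγ : Continuous γ := by fun_prop
  have hγ0 : γ 0 = p := by simp [γ]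
  have h1 : Tendsto γ (𝓝[≠] 0) (𝓝 p) := hγ0 ▸ hγ.continuousAt.tendsto.mono_left nhdsWithin_le_nhds
  have h2 : ∀ k : {k : Fin n // k ≠ a}, ∀ᶠ t : ℂ in 𝓝[≠] 0, p (Sum.inl k) + t ≠ 0 := by
    intro k
    by_cases hk : p (Sum.inl k) = 0
    · filter_upwards [self_mem_nhdsWithin] with t ht
      simpa [hk] using ht
    · refine mem_nhdsWithin_of_mem_nhds (ContinuousAt.eventually_ne (by fun_prop) ?_)
      simpa using hk
  have h3 : Tendsto γ (𝓝[≠] 0) (𝓝[{q | q ∈ dom c r a ∧ (∀ k, P k → q (Sum.inl k) ≠ 0) ∧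
      ∀ k, ¬ P k → q (Sum.inl k) = p (Sum.inl k)}] p) := by
    refine tendsto_nhdsWithin_iff.2 ⟨h1, ?_⟩
    filter_upwards [h1.eventually_mem (isOpen_dom.mem_nhds hp), eventually_all.2 h2] with t ht ht'
    refine ⟨ht, fun k hk => ?_, fun k hk => ?_⟩
    · simpa [γ, hk] using ht' k
    · simp [γ, hk]
  exact h3.neBot

theorem neBot_nhdsWithin_reg {p : Coord n m a} (hp : p ∈ dom c r a) : (𝓝[reg c r a] p).NeBot := by
  refine (neBot_nhdsWithin_ne_zero hp fun _ => True).mono (nhdsWithin_mono _ ?_)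
  rintro q ⟨h1, h2, -⟩
  exact (mem_reg c r a q).2 ⟨h1, fun k => h2 k trivial⟩

theorem neBot_nhdsWithin_regComp {p : Coord n m a} (hp : p ∈ dom c r a)
    {i : {k : Fin n // k ≠ a}} (hi : p (Sum.inl i) = 0) : (𝓝[regComp c r a i] p).NeBot := by
  refine (neBot_nhdsWithin_ne_zero hp fun k => k ≠ i).mono (nhdsWithin_mono _ ?_)
  rintro q ⟨h1, h2, h3⟩
  exact ⟨h1, by rw [h3 i (by simp), hi], h2⟩

/-- The coefficient of the logarithmic vector field named `s`: `z_k` for `z_k ∂_{z_k}` and `1` for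
`∂_{x_j}`. -/
def logCoeff (s : Idx n m a) (p : Coord n m a) : ℂ :=
  Sum.elim (fun k => p (Sum.inl k)) (fun _ => 1) s

/-- The logarithmic derivative of the local equation along a coordinate. -/
noncomputable def dlogEq (s : Idx n m a) (p : Coord n m a) : ℂ :=
  Sum.elim (fun k => (p (Sum.inl k))⁻¹) (fun _ => 0) s

theorem analyticAt_logCoeff (s : Idx n m a) (p : Coord n m a) : AnalyticAt ℂ (logCoeff s) p := by
  rcases s with k | j
  · exact (ContinuousLinearMap.proj (R := ℂ) (φ := fun _ : Idx n m a => ℂ) (Sum.inl k)).analyticAt p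
  · exact analyticAt_const

theorem continuous_logCoeff (s : Idx n m a) : Continuous (logCoeff s) :=
  continuous_iff_continuousAt.2 fun p => (analyticAt_logCoeff s p).continuousAt

theorem logCoeff_ne_zero {p : Coord n m a} (hp : p ∈ reg c r a) (s : Idx n m a) :
    logCoeff s p ≠ 0 := by
  rcases s with k | j
  · exact ((mem_reg c r a p).1 hp).2 k
  · exact one_ne_zero

theorem prod_logCoeff (p : Coord n m a) : ∏ s, logCoeff s p = localEq a p := by
  simp [Fintype.prod_sum_type, logCoeff, localEq]

theorem localEq_ne_zero {p : Coord n m a} (hp : p ∈ reg c r a) : localEq a p ≠ 0 := by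
  rw [← prod_logCoeff]
  exact Finset.prod_ne_zero_iff.2 fun s _ => logCoeff_ne_zero hp s

theorem analyticAt_localEq (p : Coord n m a) : AnalyticAt ℂ (localEq a) p := by
  have : localEq (m := m) a = fun p => ∏ s, logCoeff s p := funext fun p => (prod_logCoeff p).symm
  rw [this]
  exact Finset.analyticAt_fun_prod _ fun s _ => analyticAt_logCoeff s p

/-- The product of the logarithmic coefficients other than those named `s` and `t`. -/
def cofactor (s t : Idx n m a) (p : Coord n m a) : ℂ :=
  ∏ x ∈ (Finset.univ.erase s).erase t, logCoeff x p

theorem analyticAt_cofactor (s t : Idx n m a) (p : Coord n m a) :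
    AnalyticAt ℂ (cofactor s t) p :=
  Finset.analyticAt_fun_prod _ fun s _ => analyticAt_logCoeff s p

theorem logCoeff_mul_cofactor {s t : Idx n m a} (h : s ≠ t) (p : Coord n m a) :
    logCoeff s p * logCoeff t p * cofactor s t p = localEq a p := by
  rw [← prod_logCoeff, mul_assoc, cofactor, Finset.mul_prod_erase _ (fun x => logCoeff x p)
    (Finset.mem_erase.2 ⟨h.symm, Finset.mem_univ _⟩),
    Finset.mul_prod_erase _ (fun x => logCoeff x p) (Finset.mem_univ s)]

theorem cofactor_eq_prod (s t : Idx n m a) (p : Coord n m a) :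
    cofactor s t p = ∏ x ∈ ((Finset.univ.erase s).erase t).filter (fun x => x.isLeft = true), p x := by
  rw [cofactor, Finset.prod_filter]
  refine Finset.prod_congr rfl ?_
  rintro (k | j) - <;> simp [logCoeff]

theorem fderiv_localEq {p : Coord n m a} (hp : p ∈ reg c r a) (s : Idx n m a) :
    fderiv ℂ (localEq a) p (ev s) = localEq a p * dlogEq s p := by
  have h : HasFDerivAt (localEq (m := m) a) _ p := HasFDerivAt.finsetProd
    (u := Finset.univ) (g := fun (k : {k : Fin n // k ≠ a}) (p : Coord n m a) => p (Sum.inl k))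
    (g' := fun k => ContinuousLinearMap.proj (R := ℂ) (φ := fun _ : Idx n m a => ℂ) (Sum.inl k))
    fun k _ => (ContinuousLinearMap.proj (R := ℂ) (φ := fun _ : Idx n m a => ℂ)
      (Sum.inl k)).hasFDerivAt
  rw [h.fderiv]
  simp only [_root_.sum_apply, _root_.smul_apply,
    ContinuousLinearMap.proj_apply, smul_eq_mul, ev]
  rcases s with k | j
  · rw [Finset.sum_eq_single k]
    · have hk := ((mem_reg c r a p).1 hp).2 k
      rw [localEq, ← Finset.mul_prod_erase _ _ (Finset.mem_univ k)]
      simp only [Pi.single_eq_same, dlogEq, Sum.elim_inl]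
      field_simp
    · intro k' _ hk
      simp [hk]
    · simp
  · simp [dlogEq]

end Charts

/-! ### The logarithmic matrix of a log symplectic form -/

theorem altForm_self {E : Type*} [NormedAddCommGroup E] [NormedSpace ℂ E]
    (ω : E [⋀^Fin 2]→L[ℂ] ℂ) (u : E) : ω ![u, u] = 0 :=
  ω.map_eq_zero_of_eq _ (i := 0) (j := 1) rfl (by decide)

theorem altForm_swap {E : Type*} [NormedAddCommGroup E] [NormedSpace ℂ E]
    (ω : E [⋀^Fin 2]→L[ℂ] ℂ) (u v : E) : ω ![u, v] = -ω ![v, u] := by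
  have h := ω.toAlternatingMap.map_swap ![v, u] (i := 0) (j := 1) (by decide)
  have h1 : (![v, u] ∘ Equiv.swap (0 : Fin 2) 1 : Fin 2 → E) = ![u, v] := by
    funext i
    fin_cases i <;> simp
  rw [h1] at h
  exact h

theorem extDeriv_twoForm_apply {E : Type*} [NormedAddCommGroup E] [NormedSpace ℂ E]
    {ω : E → E [⋀^Fin 2]→L[ℂ] ℂ} {p : E} (h : DifferentiableAt ℂ ω p) (v : Fin 3 → E) :
    extDeriv ω p v = fderiv ℂ (fun q => ω q ![v 1, v 2]) p (v 0) -
      fderiv ℂ (fun q => ω q ![v 0, v 2]) p (v 1) +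
      fderiv ℂ (fun q => ω q ![v 0, v 1]) p (v 2) := by
  have h0 : (0 : Fin 3).removeNth v = ![v 1, v 2] := by funext i; fin_cases i <;> rfl
  have h1 : (1 : Fin 3).removeNth v = ![v 0, v 2] := by funext i; fin_cases i <;> rfl
  have h2 : (2 : Fin 3).removeNth v = ![v 0, v 1] := by funext i; fin_cases i <;> rfl
  rw [extDeriv_apply h, Fin.sum_univ_three, h0, h1, h2]
  simp [sub_eq_add_neg]

section Forward

variable {n m : ℕ} {c : Fin m → ℂ} {r : Fin m → ℝ} {a : Fin n}

theorem analyticAt_altForm_apply {E : Type*} [NormedAddCommGroup E] [NormedSpace ℂ E]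
    {g : E → E [⋀^Fin 2]→L[ℂ] ℂ} {p : E} (hg : AnalyticAt ℂ g p) (v : Fin 2 → E) :
    AnalyticAt ℂ (fun q => g q v) p :=
  ((ContinuousAlternatingMap.apply ℂ E ℂ v).analyticAt _).comp hg

variable {ω : Coord n m a → Coord n m a [⋀^Fin 2]→L[ℂ] ℂ}
  {g : Coord n m a → Coord n m a [⋀^Fin 2]→L[ℂ] ℂ}

/-- A `TwoForm` carries no regularity of its own; off the divisor it inherits that of `g` through `ω
= f⁻¹ g`. -/
theorem differentiableAt_of_smul_eq (hg : AnalyticOnNhd ℂ g (dom c r a))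
    (hgω : ∀ p ∈ reg c r a, localEq a p • ω p = g p) {p : Coord n m a} (hp : p ∈ reg c r a) :
    DifferentiableAt ℂ ω p := by
  have h : ω =ᶠ[𝓝 p] fun q => (localEq a q)⁻¹ • g q := by
    filter_upwards [isOpen_reg.mem_nhds hp] with q hq
    rw [← hgω q hq, inv_smul_smul₀ (localEq_ne_zero hq)]
  refine DifferentiableAt.congr_of_eventuallyEq ?_ h
  exact ((analyticAt_localEq p).differentiableAt.inv (localEq_ne_zero hp)).smul
    (hg p (reg_subset_dom hp)).differentiableAt

/-- Closedness of `ω`, in terms of the coefficients of the holomorphic form `g = f ω`. -/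
theorem closed_coeff (hg : AnalyticOnNhd ℂ g (dom c r a))
    (hgω : ∀ p ∈ reg c r a, localEq a p • ω p = g p) {p : Coord n m a} (hp : p ∈ reg c r a)
    (hclosed : extDeriv ω p = 0) (u s t : Idx n m a) :
    dlogEq u p * g p ![ev s, ev t] - dlogEq s p * g p ![ev u, ev t] +
        dlogEq t p * g p ![ev u, ev s] =
      fderiv ℂ (fun q => g q ![ev s, ev t]) p (ev u) -
        fderiv ℂ (fun q => g q ![ev u, ev t]) p (ev s) +
        fderiv ℂ (fun q => g q ![ev u, ev s]) p (ev t) := by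
  have hω := differentiableAt_of_smul_eq hg hgω hp
  have hd : ∀ v w : Idx n m a, DifferentiableAt ℂ (fun q => ω q ![ev v, ev w]) p := fun v w =>
    (ContinuousAlternatingMap.apply ℂ (Coord n m a) ℂ ![ev v, ev w]).differentiableAt.comp p hω
  have key : ∀ v w x : Idx n m a, fderiv ℂ (fun q => g q ![ev v, ev w]) p (ev x) =
      dlogEq x p * g p ![ev v, ev w] +
        localEq a p * fderiv ℂ (fun q => ω q ![ev v, ev w]) p (ev x) := by
    intro v w x
    have h : (fun q => g q ![ev v, ev w]) =ᶠ[𝓝 p] fun q => localEq a q * ω q ![ev v, ev w] := by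
      filter_upwards [isOpen_reg.mem_nhds hp] with q hq
      rw [← hgω q hq]
      rfl
    rw [h.fderiv_eq, fderiv_fun_mul (analyticAt_localEq p).differentiableAt (hd v w)]
    simp only [_root_.add_apply, _root_.smul_apply, smul_eq_mul, fderiv_localEq hp, ← hgω p hp,
      ContinuousAlternatingMap.smul_apply]
    ring
  have h0 := extDeriv_twoForm_apply hω ![ev u, ev s, ev t]
  rw [hclosed, show (0 : Coord n m a [⋀^Fin 3]→L[ℂ] ℂ) ![ev u, ev s, ev t] = 0 from rfl] at h0
  simp only [Matrix.cons_val_zero, Matrix.cons_val_one,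
    Matrix.cons_val] at h0
  rw [key, key, key]
  linear_combination (localEq a p) * h0

/-- The constant is `1` or `0`. Multiplying the closedness identity by logarithmic coefficients
therefore clears its poles along `{s = 0}` and `{t = 0}`. -/
theorem dlogEq_mul_logCoeff (s : Idx n m a) :
    ∃ χ : ℂ, ∀ p ∈ reg c r a, dlogEq s p * logCoeff s p = χ := by
  rcases s with k | j
  · exact ⟨1, fun p hp => inv_mul_cancel₀ (((mem_reg c r a p).1 hp).2 k)⟩
  · exact ⟨0, fun p _ => zero_mul _⟩

/-- The coefficient of `f ω` at `ds ∧ dt` vanishes on the components of the divisor other than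
`{s = 0}` and `{t = 0}`. -/
theorem coeff_eq_zero (hg : AnalyticOnNhd ℂ g (dom c r a))
    (hgω : ∀ p ∈ reg c r a, localEq a p • ω p = g p)
    (hclosed : ∀ p ∈ reg c r a, extDeriv ω p = 0) {s t : Idx n m a} {i : {k : Fin n // k ≠ a}}
    (hs : Sum.inl i ≠ s) (ht : Sum.inl i ≠ t) {p : Coord n m a} (hp : p ∈ dom c r a)
    (hpi : p (Sum.inl i) = 0) : g p ![ev s, ev t] = 0 := by
  have hG : ∀ x y : Idx n m a, ∀ p ∈ dom c r a, AnalyticAt ℂ (fun q => g q ![ev x, ev y]) p :=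
    fun x y p hp => analyticAt_altForm_apply (hg p hp) _
  have hD : ∀ x y z : Idx n m a, ∀ p ∈ dom c r a,
      ContinuousAt (fun q => fderiv ℂ (fun q => g q ![ev x, ev y]) q (ev z)) p :=
    fun x y z p hp => ((hG x y p hp).fderiv.continuousAt).clm_apply continuousAt_const
  obtain ⟨χs, hχs⟩ := dlogEq_mul_logCoeff (c := c) (r := r) s
  obtain ⟨χt, hχt⟩ := dlogEq_mul_logCoeff (c := c) (r := r) t
  have hcomp : ∀ p ∈ regComp c r a i, g p ![ev s, ev t] = 0 := by
    rintro p ⟨hp, hpi, hpk⟩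
    have := neBot_nhdsWithin_reg hp
    have hne : ∀ x : Idx n m a, Sum.inl i ≠ x → logCoeff x p ≠ 0 := by
      rintro (k | j) hx
      · exact hpk k fun h => hx (by rw [h])
      · exact one_ne_zero
    have hl : Tendsto (fun q => logCoeff s q * logCoeff t q * g q ![ev s, ev t]) (𝓝[reg c r a] p)
        (𝓝 (logCoeff s p * logCoeff t p * g p ![ev s, ev t])) :=
      ((((continuous_logCoeff s).continuousAt).mul ((continuous_logCoeff t).continuousAt)).mul
        (hG s t p hp).continuousAt).tendsto.mono_left nhdsWithin_le_nhds
    -- Closedness multiplied by `z_i` and by both logarithmic coefficients, solved for the term in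
    -- `ds ∧ dt`. The result is `z_i` times a continuous function, hence vanishes on `D_i`.
    let Ψ : Coord n m a → ℂ := fun q => q (Sum.inl i) *
      (logCoeff s q * logCoeff t q * (fderiv ℂ (fun q => g q ![ev s, ev t]) q (ev (Sum.inl i)) -
        fderiv ℂ (fun q => g q ![ev (Sum.inl i), ev t]) q (ev s) +
        fderiv ℂ (fun q => g q ![ev (Sum.inl i), ev s]) q (ev t)) +
      χs * logCoeff t q * g q ![ev (Sum.inl i), ev t] -
      χt * logCoeff s q * g q ![ev (Sum.inl i), ev s])
    have hΨc : ContinuousAt Ψ p := by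
      have h1 := (continuous_logCoeff s).continuousAt (x := p)
      have h2 := (continuous_logCoeff t).continuousAt (x := p)
      have h3 : ContinuousAt (fun q : Coord n m a => q (Sum.inl i)) p :=
        (continuous_apply _).continuousAt
      exact h3.mul ((((h1.mul h2).mul (((hD _ _ _ p hp).sub (hD _ _ _ p hp)).add
        (hD _ _ _ p hp))).add ((continuousAt_const.mul h2).mul (hG _ _ p hp).continuousAt)).sub
        ((continuousAt_const.mul h1).mul (hG _ _ p hp).continuousAt))
    have hΨ0 : Ψ p = 0 := by simp [Ψ, hpi]
    have hr : Tendsto Ψ (𝓝[reg c r a] p) (𝓝 0) :=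
      hΨ0 ▸ hΨc.tendsto.mono_left nhdsWithin_le_nhds
    have heq : (fun q => logCoeff s q * logCoeff t q * g q ![ev s, ev t])
        =ᶠ[𝓝[reg c r a] p] Ψ := by
      filter_upwards [self_mem_nhdsWithin] with q hq
      have h1 := closed_coeff hg hgω hq (hclosed q hq) (Sum.inl i) s t
      have h2 : q (Sum.inl i) * dlogEq (Sum.inl i) q = 1 :=
        mul_inv_cancel₀ (((mem_reg c r a q).1 hq).2 i)
      simp only [Ψ]
      rw [← h1, ← hχs q hq, ← hχt q hq]
      linear_combination -(logCoeff s q * logCoeff t q * g q ![ev s, ev t]) * h2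
    have := tendsto_nhds_unique (hl.congr' heq) hr
    exact (mul_eq_zero.1 this).resolve_left (mul_ne_zero (hne s hs) (hne t ht))
  -- Every point of `D_i` is a limit of points of `D_i` on no other component, so continuity
  -- finishes.
  have := neBot_nhdsWithin_regComp hp hpi
  refine tendsto_nhds_unique (l := 𝓝[regComp c r a i] p)
    ((hG s t p hp).continuousAt.tendsto.mono_left nhdsWithin_le_nhds)
    (tendsto_const_nhds.congr' ?_)
  filter_upwards [self_mem_nhdsWithin] with q hq
  exact (hcomp q hq).symm

/-- The coefficients of a closed form with a simple pole in the logarithmic frame extend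
continuously to the deepest stratum of the divisor. -/
theorem exists_tendsto_logMatrix (hg : AnalyticOnNhd ℂ g (dom c r a))
    (hgω : ∀ p ∈ reg c r a, localEq a p • ω p = g p)
    (hclosed : ∀ p ∈ reg c r a, extDeriv ω p = 0) {O : Coord n m a} (hO : O ∈ dom c r a)
    (hO0 : ∀ k, O (Sum.inl k) = 0) (s t : Idx n m a) :
    ∃ L, Tendsto (fun q => logCoeff s q * logCoeff t q * ω q ![ev s, ev t]) (𝓝[reg c r a] O)
      (𝓝 L) := by
  by_cases hst : s = t
  · refine ⟨0, ?_⟩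
    subst hst
    simp only [altForm_self, mul_zero]
    exact tendsto_const_nhds
  have hS : ∀ x ∈ ((Finset.univ.erase s).erase t).filter (fun x => x.isLeft = true),
      ∃ i, x = Sum.inl i ∧ Sum.inl i ≠ s ∧ Sum.inl i ≠ t := by
    intro x hx
    rcases x with i | j
    · simp only [Finset.mem_filter, Finset.mem_erase] at hx
      exact ⟨i, rfl, hx.1.2.1, hx.1.1⟩
    · simp at hx
  obtain ⟨L, hL⟩ := exists_tendsto_div_prod isOpen_dom hO
    (((Finset.univ.erase s).erase t).filter (fun x => x.isLeft = true))
    (fun x hx => by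
      obtain ⟨i, rfl, -⟩ := hS x hx
      exact hO0 i)
    (F := fun q => g q ![ev s, ev t]) (fun p hp => analyticAt_altForm_apply (hg p hp) _)
    (fun x hx p hp hpx => by
      obtain ⟨i, rfl, h1, h2⟩ := hS x hx
      exact coeff_eq_zero hg hgω hclosed h1 h2 hp hpx)
    (R := reg c r a) (fun q hq x hx => by
      obtain ⟨i, rfl, -⟩ := hS x hx
      exact ((mem_reg c r a q).1 hq).2 i)
  refine ⟨L, hL.congr' ?_⟩
  filter_upwards [self_mem_nhdsWithin] with q hq
  -- The logarithmic coefficient of `ω` is the coefficient of `f ω` divided by the equations of the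
  -- other components.
  rw [← cofactor_eq_prod, ← hgω q hq]
  have h := logCoeff_mul_cofactor hst q
  have h0 := localEq_ne_zero hq
  have hc : cofactor s t q ≠ 0 := fun hc => h0 (by rw [← h, hc, mul_zero])
  rw [ContinuousAlternatingMap.smul_apply, smul_eq_mul, ← h]
  field_simp

/-- The factor `f` is exactly what rescales the coordinate frame to the logarithmic one. -/
theorem localEq_mul_wedgePow {k : ℕ} (e : Fin k × Fin 2 ≃ Idx n m a)
    (η : Coord n m a [⋀^Fin 2]→L[ℂ] ℂ) (q : Coord n m a) :
    localEq a q * wedgePow η k (fun x => ev (e x)) = (2 ^ k : ℂ)⁻¹ * pfSum (Matrix.of fun x y =>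
      logCoeff (e x) q * logCoeff (e y) q * η ![ev (e x), ev (e y)]) := by
  have h := pfSum_scale (Matrix.of fun x y => η ![ev (e x), ev (e y)])
    (fun x => logCoeff (e x) q)
  simp only [Matrix.of_apply] at h
  rw [h, e.prod_comp fun s => logCoeff s q, prod_logCoeff]
  simp only [wedgePow, pfSum, Matrix.of_apply]
  ring

end Forward

/-! ### Necessity of the rank condition -/

theorem sub_one_le_add_rank_of_minor {n m : ℕ} {B : Matrix (Fin n) (Fin n) ℂ} {a : Fin n}
    {L : Matrix (Idx n m a) (Idx n m a) ℂ} (hLB : ∀ i j, L (Sum.inl i) (Sum.inl j) = B i j)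
    (hL : ∀ w, L.mulVec w = 0 → w = 0) : n - 1 ≤ m + B.rank := by
  let ext : ({k : Fin n // k ≠ a} → ℂ) →ₗ[ℂ] (Fin n → ℂ) :=
    LinearMap.pi fun k => if h : k = a then 0 else LinearMap.proj ⟨k, h⟩
  let pad : ({k : Fin n // k ≠ a} → ℂ) →ₗ[ℂ] (Idx n m a → ℂ) :=
    LinearMap.pi (Sum.elim (fun k => LinearMap.proj k) fun _ => 0)
  -- A vector `w` in the `z` directions goes to the `x` rows of `L (w, 0)` and to `B` applied to `w`
  -- extended by zero at `a`. Together these determine `L (w, 0)`, so `T` is injective.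
  let T : ({k : Fin n // k ≠ a} → ℂ) →ₗ[ℂ] (Fin m → ℂ) × LinearMap.range B.mulVecLin :=
    LinearMap.prod (LinearMap.funLeft ℂ ℂ Sum.inr ∘ₗ L.mulVecLin ∘ₗ pad)
      (B.mulVecLin.rangeRestrict ∘ₗ ext)
  have hT : Function.Injective T := by
    refine (injective_iff_map_eq_zero T).2 fun w hw => ?_
    have h1 : ∀ j, L.mulVec (pad w) (Sum.inr j) = 0 := fun j =>
      congrFun (congrArg Prod.fst hw) j
    have h2 : B.mulVec (ext w) = 0 := congrArg (fun z => (z.2 : Fin n → ℂ)) hw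
    have h3 : pad w = 0 := by
      refine hL _ (funext fun s => ?_)
      rcases s with i | j
      · refine Eq.trans ?_ (congrFun h2 i)
        simp only [Matrix.mulVec, dotProduct]
        rw [Fintype.sum_sum_type, ← Fintype.sum_subtype_add_sum_subtype (fun k => k ≠ a)]
        congr 1
        · refine Finset.sum_congr rfl fun k _ => ?_
          simp [pad, ext, k.2, hLB]
        · rw [Finset.sum_eq_zero, Finset.sum_eq_zero]
          · rintro ⟨k, hk⟩ -
            simp [ext, not_not.1 hk]
          · intro j _
            simp [pad]
      · exact h1 j
    funext k
    exact congrFun h3 (Sum.inl k)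
  have h := LinearMap.finrank_le_finrank_of_injective hT
  rw [Module.finrank_prod, Module.finrank_fin_fun, Module.finrank_fintype_fun_eq_card,
    Fintype.card_subtype_compl, Fintype.card_fin, Fintype.card_subtype_eq] at h
  exact h

theorem rank_le_of_isLogSymplectic {n m : ℕ} (hn : 0 < n) {c : Fin m → ℂ} {r : Fin m → ℝ}
    (hr : ∀ j, 0 < r j) {B : Matrix (Fin n) (Fin n) ℂ} (hskew : B.transpose = -B)
    {ω : TwoForm n c r} (hω : IsLogSymplectic ω) (hB : HasBiresidues ω B) :
    n - 1 ≤ m + B.rank := by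
  let a : Fin n := ⟨0, hn⟩
  -- A deepest point of the chart: all `z_k` vanish, and `x` is the centre of the polydisc.
  let O : Coord n m a := Sum.elim (fun _ => 0) c
  have hO : O ∈ dom c r a := (mem_dom c r a O).2 fun j => by simpa [O] using hr j
  obtain ⟨g, hg, hgω⟩ := hω.simplePole a
  choose L hL using fun s t => exists_tendsto_logMatrix hg hgω (hω.closed a) hO (fun _ => rfl) s t
  have hregO := neBot_nhdsWithin_reg hO
  have hLskew : ∀ s t, L s t = -L t s := by
    intro s t
    refine tendsto_nhds_unique (hL s t) (((hL t s).neg).congr fun q => ?_)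
    rw [altForm_swap _ (ev t) (ev s)]
    ring
  have hLB : ∀ i j : {k : Fin n // k ≠ a}, L (Sum.inl i) (Sum.inl j) = B i j := by
    intro i j
    by_cases hij : i = j
    · subst hij
      have hBi : B i i = -B i i := congrFun (congrFun hskew i) i
      rw [self_eq_neg.1 (hLskew _ _), self_eq_neg.1 hBi]
    obtain ⟨α, hα, hαB⟩ := hB a i j hij
    have := neBot_nhdsWithin_regComp hO (i := i) rfl
    -- The biresidue is an iterated limit, first to points of `D_i` and then to `O`; it must agree
    -- with the joint limit `L`.
    refine (eq_of_tendsto_iterated (hL (Sum.inl i) (Sum.inl j)) (S := regComp c r a i)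
      (fun p hp => ?_) (fun p hp => neBot_nhdsWithin_reg hp.1) (hαB O hO rfl rfl)).symm
    have h1 := hα p hp (ev (Sum.inl j)) (by simp [ev, hij])
    have h2 : Tendsto (fun q : Coord n m a => q (Sum.inl j)) (𝓝[reg c r a] p)
        (𝓝 (p (Sum.inl j))) := (continuous_apply _).continuousAt.tendsto.mono_left
      nhdsWithin_le_nhds
    refine (h2.mul h1).congr fun q => ?_
    simp only [logCoeff, Sum.elim_inl]
    ring
  obtain ⟨k, hk, hpf⟩ := hω.pfaffian
  have hcard : Fintype.card (Fin k × Fin 2) = Fintype.card (Idx n m a) := by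
    simp [Fintype.card_subtype_compl, hk, mul_comm]
  let e : Fin k × Fin 2 ≃ Idx n m a := Fintype.equivOfCardEq hcard
  obtain ⟨h, hh, hh0, hheq⟩ := hpf a e
  let Le : Matrix (Fin k × Fin 2) (Fin k × Fin 2) ℂ := Matrix.of fun x y => L (e x) (e y)
  have hLe : pfSum Le ≠ 0 := by
    have h1 : Tendsto (fun q => (Matrix.of fun x y => logCoeff (e x) q * logCoeff (e y) q *
        ω.expr a q ![ev (e x), ev (e y)] : Matrix (Fin k × Fin 2) (Fin k × Fin 2) ℂ))
        (𝓝[reg c r a] O) (𝓝 Le) :=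
      tendsto_pi_nhds.2 fun x => tendsto_pi_nhds.2 fun y => hL (e x) (e y)
    have h2 := ((continuous_pfSum.tendsto Le).comp h1).const_mul ((2 ^ k : ℂ)⁻¹)
    have h3 : Tendsto h (𝓝[reg c r a] O) (𝓝 (h O)) :=
      (hh O hO).continuousAt.tendsto.mono_left nhdsWithin_le_nhds
    -- The nonvanishing function `h` has at `O` the value `2⁻ᵏ` times `pfSum Le`.
    have h4 := tendsto_nhds_unique h3 (h2.congr' (by
      filter_upwards [self_mem_nhdsWithin] with q hq
      rw [← hheq q hq, localEq_mul_wedgePow]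
      rfl))
    intro h0
    rw [h0, mul_zero] at h4
    exact hh0 O hO h4
  refine sub_one_le_add_rank_of_minor (a := a) (L := Matrix.of L) hLB fun w hw => ?_
  by_contra hw0
  refine hLe (pfSum_eq_zero_of_mulVec (w := w ∘ e) ?_ ?_ ?_)
  · ext x y
    exact hLskew _ _
  · intro h0
    refine hw0 (funext fun s => ?_)
    have := congrFun h0 (e.symm s)
    simpa using this
  · funext x
    refine Eq.trans ?_ (congrFun hw (e x))
    exact e.sum_comp fun s => L (e x) s * w s

noncomputable section

/-! ### Semi-toric forms with prescribed logarithmic matrix -/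

section Toric

variable {n m : ℕ} {c : Fin m → ℂ} {r : Fin m → ℝ} {a : Fin n}

/-- The constant `2`-form `ds ∧ dt` on an affine chart. -/
def coordWedge (s t : Idx n m a) : Coord n m a [⋀^Fin 2]→L[ℂ] ℂ :=
  ContinuousMultilinearMap.alternatization
    ((ContinuousMultilinearMap.mkPiAlgebra ℂ (Fin 2) ℂ).compContinuousLinearMap
      ![ContinuousLinearMap.proj s, ContinuousLinearMap.proj t])

theorem coordWedge_apply (s t : Idx n m a) (u v : Coord n m a) :
    coordWedge s t ![u, v] = u s * v t - u t * v s := by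
  have h : (Finset.univ : Finset (Equiv.Perm (Fin 2))) = {1, Equiv.swap 0 1} := by decide
  rw [coordWedge, ContinuousMultilinearMap.alternatization_apply_apply, h,
    Finset.sum_pair (by decide)]
  simp [Fin.prod_univ_two]
  ring

theorem coordWedge_self (s : Idx n m a) : coordWedge s s = 0 := by
  ext v
  have h : v = ![v 0, v 1] := by funext i; fin_cases i <;> rfl
  rw [h, coordWedge_apply]
  exact sub_self _

/-- The form `½ ∑ N_{st} dlog s ∧ dlog t` on an affine chart, where `dlog x_j` stands for `dx_j`. -/
def toricForm (N : Matrix (Fin n ⊕ Fin m) (Fin n ⊕ Fin m) ℂ) (a : Fin n) (p : Coord n m a) :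
    Coord n m a [⋀^Fin 2]→L[ℂ] ℂ :=
  ∑ s, ∑ t, (N (incl a s) (incl a t) / 2 * ((logCoeff s p)⁻¹ * (logCoeff t p)⁻¹)) • coordWedge s t

variable {N : Matrix (Fin n ⊕ Fin m) (Fin n ⊕ Fin m) ℂ}

theorem toricForm_apply' (p u v : Coord n m a) :
    toricForm N a p ![u, v] = ∑ s, ∑ t, N (incl a s) (incl a t) / 2 *
      ((logCoeff s p)⁻¹ * (logCoeff t p)⁻¹) * (u s * v t - u t * v s) := by
  simp only [toricForm, ContinuousAlternatingMap.sum_apply, ContinuousAlternatingMap.smul_apply,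
    coordWedge_apply, smul_eq_mul]

theorem toricForm_apply (hN : N.transpose = -N) (p u v : Coord n m a) :
    toricForm N a p ![u, v] = ∑ s, ∑ t, N (incl a s) (incl a t) *
      ((logCoeff s p)⁻¹ * u s * ((logCoeff t p)⁻¹ * v t)) := by
  have h : ∑ s, ∑ t, N (incl a s) (incl a t) / 2 * ((logCoeff s p)⁻¹ * (logCoeff t p)⁻¹) *
      (u t * v s) = -∑ s, ∑ t, N (incl a s) (incl a t) / 2 *
        ((logCoeff s p)⁻¹ * (logCoeff t p)⁻¹) * (u s * v t) := by
    rw [Finset.sum_comm, ← Finset.sum_neg_distrib]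
    refine Finset.sum_congr rfl fun s _ => ?_
    rw [← Finset.sum_neg_distrib]
    refine Finset.sum_congr rfl fun t _ => ?_
    rw [show N (incl a t) (incl a s) = -N (incl a s) (incl a t) from
      congrFun (congrFun hN (incl a s)) (incl a t)]
    ring
  rw [toricForm_apply']
  simp only [mul_sub, Finset.sum_sub_distrib]
  rw [h, sub_neg_eq_add, ← Finset.sum_add_distrib]
  refine Finset.sum_congr rfl fun s _ => ?_
  rw [← Finset.sum_add_distrib]
  refine Finset.sum_congr rfl fun t _ => ?_
  ring

theorem toricForm_ev (hN : N.transpose = -N) (p : Coord n m a) (s : Idx n m a)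
    (v : Coord n m a) : toricForm N a p ![ev s, v] =
      (logCoeff s p)⁻¹ * ∑ t, N (incl a s) (incl a t) * ((logCoeff t p)⁻¹ * v t) := by
  rw [toricForm_apply hN, Finset.sum_eq_single s, Finset.mul_sum]
  · refine Finset.sum_congr rfl fun t _ => ?_
    simp only [ev, Pi.single_eq_same]
    ring
  · intro s' _ hs
    simp [ev, hs]
  · simp

theorem toricForm_ev_ev (hN : N.transpose = -N) (p : Coord n m a) (s t : Idx n m a) :
    toricForm N a p ![ev s, ev t] =
      N (incl a s) (incl a t) * ((logCoeff s p)⁻¹ * (logCoeff t p)⁻¹) := by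
  rw [toricForm_ev hN, Finset.sum_eq_single t]
  · simp only [ev, Pi.single_eq_same]
    ring
  · intro t' _ ht
    simp [ev, ht]
  · simp

theorem hasFDerivAt_inv_logCoeff {p : Coord n m a} (hp : p ∈ reg c r a) (s : Idx n m a) :
    HasFDerivAt (fun q => (logCoeff s q)⁻¹) (-((logCoeff s p)⁻¹ * dlogEq s p) •
      (ContinuousLinearMap.proj s : Coord n m a →L[ℂ] ℂ)) p := by
  rcases s with k | j
  · have h := (hasDerivAt_inv (((mem_reg c r a p).1 hp).2 k)).comp_hasFDerivAt p
      (ContinuousLinearMap.proj (R := ℂ) (φ := fun _ : Idx n m a => ℂ) (Sum.inl k)).hasFDerivAt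
    refine h.congr_fderiv ?_
    congr 1
    simp only [logCoeff, dlogEq, Sum.elim_inl]
    ring
  · have h : (-((logCoeff (Sum.inr j : Idx n m a) p)⁻¹ * dlogEq (Sum.inr j : Idx n m a) p) •
        (ContinuousLinearMap.proj (Sum.inr j) : Coord n m a →L[ℂ] ℂ)) = 0 := by
      simp only [dlogEq, Sum.elim_inr, mul_zero, neg_zero]
      exact zero_smul ℂ (ContinuousLinearMap.proj (Sum.inr j) : Coord n m a →L[ℂ] ℂ)
    rw [h]
    exact hasFDerivAt_const ((1 : ℂ)⁻¹) p

theorem hasFDerivAt_toricForm {p : Coord n m a} (hp : p ∈ reg c r a) :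
    HasFDerivAt (toricForm N a) (∑ s, ∑ t, ((N (incl a s) (incl a t) / 2) •
      ((logCoeff s p)⁻¹ • (-((logCoeff t p)⁻¹ * dlogEq t p) •
        (ContinuousLinearMap.proj t : Coord n m a →L[ℂ] ℂ)) +
      (logCoeff t p)⁻¹ • (-((logCoeff s p)⁻¹ * dlogEq s p) •
        (ContinuousLinearMap.proj s : Coord n m a →L[ℂ] ℂ)))).smulRight (coordWedge s t)) p :=
  by
  refine HasFDerivAt.fun_sum fun s _ => HasFDerivAt.fun_sum fun t _ => ?_
  have h := ((hasFDerivAt_inv_logCoeff hp s).fun_mul (hasFDerivAt_inv_logCoeff hp t)).const_mul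
    (N (incl a s) (incl a t) / 2)
  exact h.smul_const (coordWedge s t)

theorem fderiv_toricForm_apply {p : Coord n m a} (hp : p ∈ reg c r a) (w u v : Coord n m a) :
    fderiv ℂ (toricForm N a) p w ![u, v] = ∑ s, ∑ t, N (incl a s) (incl a t) / 2 *
      ((logCoeff s p)⁻¹ * (logCoeff t p)⁻¹) * (-(dlogEq s p * w s) - dlogEq t p * w t) *
        (u s * v t - u t * v s) := by
  rw [(hasFDerivAt_toricForm hp).fderiv]
  simp only [_root_.sum_apply, ContinuousAlternatingMap.sum_apply,
    ContinuousLinearMap.smulRight_apply, ContinuousAlternatingMap.smul_apply, coordWedge_apply,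
    _root_.smul_apply, _root_.add_apply, ContinuousLinearMap.proj_apply, smul_eq_mul]
  refine Finset.sum_congr rfl fun s _ => Finset.sum_congr rfl fun t _ => ?_
  ring

/-- Each `dlog s ∧ dlog t` is closed separately, so the sum vanishes term by term. -/
theorem extDeriv_toricForm {p : Coord n m a} (hp : p ∈ reg c r a) :
    extDeriv (toricForm N a) p = 0 := by
  have hd := (hasFDerivAt_toricForm (N := N) hp).differentiableAt
  ext v
  have key : ∀ u w x : Coord n m a, fderiv ℂ (fun q => toricForm N a q ![u, w]) p x =
      fderiv ℂ (toricForm N a) p x ![u, w] := by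
    intro u w x
    have h := (ContinuousAlternatingMap.apply ℂ (Coord n m a) ℂ ![u, w]).hasFDerivAt.comp p
      hd.hasFDerivAt
    have h' : fderiv ℂ (fun q => toricForm N a q ![u, w]) p = _ := h.fderiv
    rw [h']
    rfl
  rw [extDeriv_twoForm_apply hd, key, key, key, fderiv_toricForm_apply hp,
    fderiv_toricForm_apply hp, fderiv_toricForm_apply hp]
  rw [← Finset.sum_sub_distrib, ← Finset.sum_add_distrib]
  refine Finset.sum_eq_zero fun s _ => ?_
  rw [← Finset.sum_sub_distrib, ← Finset.sum_add_distrib]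
  refine Finset.sum_eq_zero fun t _ => ?_
  ring

/-- The logarithmic derivatives of the homogeneous coordinates (normalized by `yₐ = 1`) and the
derivatives of the `x_j`, along a tangent vector. -/
def dlogHomog (a : Fin n) (p u : Coord n m a) : Fin n ⊕ Fin m → ℂ :=
  Sum.elim (fun k => if h : k = a then 0 else (p (Sum.inl ⟨k, h⟩))⁻¹ * u (Sum.inl ⟨k, h⟩))
    fun j => u (Sum.inr j)

theorem dlogHomog_incl (p u : Coord n m a) (s : Idx n m a) :
    dlogHomog a p u (incl a s) = (logCoeff s p)⁻¹ * u s := by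
  rcases s with ⟨k, hk⟩ | j
  · simp [dlogHomog, incl, hk, logCoeff]
  · simp [dlogHomog, incl, logCoeff]

/-- All homogeneous coordinates now enter symmetrically, which makes charts comparable; index `a`
adds nothing because `yₐ = 1` in its chart. -/
theorem toricForm_eq_sum_dlogHomog (hN : N.transpose = -N) (p u v : Coord n m a) :
    toricForm N a p ![u, v] =
      ∑ S, ∑ T, N S T * (dlogHomog a p u S * dlogHomog a p v T) := by
  have h0 : ∀ w : Coord n m a, dlogHomog a p w (Sum.inl a) = 0 := fun w => by simp [dlogHomog]
  rw [toricForm_apply hN, ← sum_incl a _ (by simp [h0])]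
  refine Finset.sum_congr rfl fun s _ => ?_
  rw [← sum_incl a _ (by simp [h0])]
  simp only [dlogHomog_incl]

theorem homog_ne_zero_of_mem_reg {p : Coord n m a} (hp : p ∈ reg c r a) (k : Fin n) :
    homog a p k ≠ 0 := by
  by_cases h : k = a
  · subst h
    simp [homog_self]
  · rw [homog_of_ne a p ⟨k, h⟩]
    exact ((mem_reg c r a p).1 hp).2 _

theorem hasFDerivAt_homog (p : Coord n m a) (k : Fin n) :
    HasFDerivAt (fun q : Coord n m a => homog a q k)
      (if h : k = a then (0 : Coord n m a →L[ℂ] ℂ)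
        else ContinuousLinearMap.proj (Sum.inl ⟨k, h⟩)) p := by
  by_cases h : k = a
  · simp only [homog, h, dite_true]
    exact hasFDerivAt_const _ _
  · simp only [homog, h, dite_false]
    exact (ContinuousLinearMap.proj (R := ℂ) (φ := fun _ : Idx n m a => ℂ) _).hasFDerivAt

theorem homog_derivative_apply {p : Coord n m a} (hp : p ∈ reg c r a) (k : Fin n)
    (u : Coord n m a) :
    (if h : k = a then (0 : Coord n m a →L[ℂ] ℂ) else ContinuousLinearMap.proj (Sum.inl ⟨k, h⟩)) u =
      homog a p k * dlogHomog a p u (Sum.inl k) := by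
  by_cases h : k = a
  · simp [h, dlogHomog]
  · have := ((mem_reg c r a p).1 hp).2 ⟨k, h⟩
    simp [h, dlogHomog, homog, this]

/-- The logarithmic derivatives of homogeneous coordinates in two charts differ by a multiple of
the Euler direction. -/
theorem dlogHomog_transition {p : Coord n m a} (hp : p ∈ reg c r a) (b : Fin n)
    (u : Coord n m a) (S : Fin n ⊕ Fin m) :
    dlogHomog b (transition a b p) (fderiv ℂ (transition a b) p u) S =
      dlogHomog a p u S -
        Sum.elim (fun _ : Fin n => dlogHomog a p u (Sum.inl b)) (fun _ : Fin m => 0) S := by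
  have hb := homog_ne_zero_of_mem_reg hp b
  have hk : ∀ k : {k : Fin n // k ≠ b}, HasFDerivAt
      (fun q : Coord n m a => homog a q k * (homog a q b)⁻¹) _ p := fun k =>
    (hasFDerivAt_homog p k).fun_mul
      ((hasDerivAt_inv hb).comp_hasFDerivAt p (hasFDerivAt_homog p b))
  have hkt : ∀ k : {k : Fin n // k ≠ b}, (fun q : Coord n m a => transition a b q (Sum.inl k)) =
      fun q => homog a q k * (homog a q b)⁻¹ := fun k => funext fun q => div_eq_mul_inv _ _
  have hj : ∀ j, HasFDerivAt (fun q : Coord n m a => transition a b q (Sum.inr j))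
      (ContinuousLinearMap.proj (Sum.inr j) : Coord n m a →L[ℂ] ℂ) p := fun j =>
    (ContinuousLinearMap.proj (R := ℂ) (φ := fun _ : Idx n m a => ℂ) (Sum.inr j)).hasFDerivAt
  have hd : ∀ s, DifferentiableAt ℂ (fun q : Coord n m a => transition a b q s) p := by
    rintro (k | j)
    exacts [hkt k ▸ (hk k).differentiableAt, (hj j).differentiableAt]
  have hap : ∀ s, fderiv ℂ (transition a b) p u s =
      fderiv ℂ (fun q : Coord n m a => transition a b q s) p u := fun s => by
    rw [fderiv_pi hd]
    rfl
  rcases S with k | j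
  · by_cases h : k = b
    · subst h
      simp [dlogHomog]
    · have hk0 := homog_ne_zero_of_mem_reg hp k
      have h1 : dlogHomog b (transition a b p) (fderiv ℂ (transition a b) p u) (Sum.inl k) =
          (homog a p k / homog a p b)⁻¹ * fderiv ℂ (transition a b) p u (Sum.inl ⟨k, h⟩) := by
        simp [dlogHomog, h, transition]
      rw [h1, hap, hkt, (hk ⟨k, h⟩).fderiv]
      simp only [_root_.add_apply, _root_.smul_apply, smul_eq_mul, homog_derivative_apply hp,
        Sum.elim_inl]
      field_simp
      ring
  · have h1 : dlogHomog b (transition a b p) (fderiv ℂ (transition a b) p u) (Sum.inr j) =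
        fderiv ℂ (transition a b) p u (Sum.inr j) := rfl
    rw [h1, hap, (hj j).fderiv]
    simp [dlogHomog]

/-- The semi-toric form on `X` with logarithmic matrix `N`. -/
def toricTwoForm (hN : IsToricMatrix N) (c : Fin m → ℂ) (r : Fin m → ℝ) : TwoForm n c r where
  expr := toricForm N
  compat a b p hp := by
    ext v
    have hv : v = ![v 0, v 1] := by funext i; fin_cases i <;> rfl
    have hL : ∀ L : Coord n m a →L[ℂ] Coord n m b, (⇑L ∘ ![v 0, v 1]) = ![L (v 0), L (v 1)] :=
      fun L => by funext i; fin_cases i <;> rfl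
    rw [hv, ContinuousAlternatingMap.compContinuousLinearMap_apply, hL,
      toricForm_eq_sum_dlogHomog hN.skew, toricForm_eq_sum_dlogHomog hN.skew]
    -- Changing charts shifts the logarithmic derivatives by a multiple of the Euler vector, which
    -- `N` kills on either side.
    have hrow : ∀ S (κ : ℂ), ∑ T, N S T *
        Sum.elim (fun _ : Fin n => κ) (fun _ : Fin m => 0) T = 0 := by
      intro S κ
      simp [Fintype.sum_sum_type, ← Finset.sum_mul, hN.row_sum]
    have hcol : ∀ T (κ : ℂ), ∑ S, N S T *
        Sum.elim (fun _ : Fin n => κ) (fun _ : Fin m => 0) S = 0 := by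
      intro T κ
      rw [← neg_eq_zero, ← Finset.sum_neg_distrib]
      refine Eq.trans (Finset.sum_congr rfl fun S _ => ?_) (hrow T κ)
      rw [show N T S = -N S T from congrFun (congrFun hN.skew S) T, neg_mul]
    simp only [dlogHomog_transition hp]
    have h1 : ∀ x y z : Fin n ⊕ Fin m → ℂ, (∀ S, ∑ T, N S T * z T = 0) →
        ∑ S, ∑ T, N S T * (x S * (y T - z T)) = ∑ S, ∑ T, N S T * (x S * y T) := by
      intro x y z hz
      refine Finset.sum_congr rfl fun S _ => ?_
      rw [← sub_zero (∑ T, N S T * (x S * y T)), ← mul_zero (x S), ← hz S, Finset.mul_sum,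
        ← Finset.sum_sub_distrib]
      exact Finset.sum_congr rfl fun T _ => by ring
    have h2 : ∀ x y z : Fin n ⊕ Fin m → ℂ, (∀ T, ∑ S, N S T * z S = 0) →
        ∑ S, ∑ T, N S T * ((x S - z S) * y T) = ∑ S, ∑ T, N S T * (x S * y T) := by
      intro x y z hz
      rw [Finset.sum_comm, Finset.sum_comm (f := fun S T => N S T * (x S * y T))]
      refine Finset.sum_congr rfl fun T _ => ?_
      rw [← sub_zero (∑ S, N S T * (x S * y T)), ← mul_zero (y T), ← hz T, Finset.mul_sum,
        ← Finset.sum_sub_distrib]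
      exact Finset.sum_congr rfl fun S _ => by ring
    rw [h1 _ _ _ fun S => hrow S _, h2 _ _ _ fun T => hcol T _]

theorem isSemiToric_toricTwoForm (hN : IsToricMatrix N) : IsSemiToric (toricTwoForm hN c r) where
  toric a k p hp u v := by
    have hpk := ((mem_reg c r a p).1 hp).2 k
    have hV : fderiv ℂ (fun q : Coord n m a => q (Sum.inl k) • (ev (Sum.inl k) : Coord n m a)) p =
        (ContinuousLinearMap.proj (Sum.inl k) : Coord n m a →L[ℂ] ℂ).smulRight (ev (Sum.inl k)) :=
      ((ContinuousLinearMap.proj (R := ℂ) (φ := fun _ : Idx n m a => ℂ)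
        (Sum.inl k)).hasFDerivAt.smul_const _).fderiv
    rw [lieDeriv, hV]
    change fderiv ℂ (toricForm N a) p _ _ + toricForm N a p _ + toricForm N a p _ = 0
    rw [fderiv_toricForm_apply hp, toricForm_apply', toricForm_apply', ← Finset.sum_add_distrib,
      ← Finset.sum_add_distrib]
    refine Finset.sum_eq_zero fun s _ => ?_
    rw [← Finset.sum_add_distrib, ← Finset.sum_add_distrib]
    refine Finset.sum_eq_zero fun t _ => ?_
    simp only [ContinuousLinearMap.smulRight_apply, ContinuousLinearMap.proj_apply,
      Pi.smul_apply, smul_eq_mul, ev]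
    have hd : dlogEq (Sum.inl k) p * p (Sum.inl k) = 1 := inv_mul_cancel₀ hpk
    -- When exactly one of `s`, `t` is `z_k`, the `-1` from differentiating `1 / z_k` cancels the
    -- contribution of the derivative of the field. In the other cases every term vanishes.
    by_cases hs : s = Sum.inl k <;> by_cases ht : t = Sum.inl k
    · subst hs ht
      ring
    · subst hs
      simp only [Pi.single_eq_same, Pi.single_eq_of_ne ht, mul_one, mul_zero, hd]
      ring
    · subst ht
      simp only [Pi.single_eq_same, Pi.single_eq_of_ne hs, mul_one, mul_zero, hd]
      ring
    · simp only [Pi.single_eq_of_ne hs, Pi.single_eq_of_ne ht]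
      ring
  translation a j p hp u v := by
    rw [lieDeriv]
    change fderiv ℂ (toricForm N a) p _ _ + toricForm N a p _ + toricForm N a p _ = 0
    have h0 : ∀ s : Idx n m a, dlogEq s p * (ev (Sum.inr j) : Coord n m a) s = 0 := by
      rintro (k | i) <;> simp [dlogEq, ev]
    rw [fderiv_toricForm_apply hp, toricForm_apply', toricForm_apply']
    simp [h0]

/-- The residue along `D_i` is `∑ N_{it} dlog t` over `t ≠ z_i`, and its coefficient at `dlog z_j`
is constant. -/
theorem hasBiresidues_toricTwoForm (hN : IsToricMatrix N) :
    HasBiresidues (toricTwoForm hN c r)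
      (Matrix.of fun i j => N (Sum.inl i) (Sum.inl j)) := by
  intro a i j hij
  have happ : ∀ q v, (∑ t, (N (Sum.inl i) (incl a t) * (logCoeff t q)⁻¹) •
      (ContinuousLinearMap.proj t : Coord n m a →L[ℂ] ℂ)) v =
        ∑ t, N (Sum.inl i) (incl a t) * ((logCoeff t q)⁻¹ * v t) := by
    intro q v
    simp [_root_.sum_apply, mul_assoc]
  refine ⟨fun q => ∑ t, (N (Sum.inl i) (incl a t) * (logCoeff t q)⁻¹) •
    (ContinuousLinearMap.proj t : Coord n m a →L[ℂ] ℂ), ?_, ?_⟩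
  · intro p hp v hv
    rw [happ]
    have h1 : Tendsto (fun q => ∑ t, N (Sum.inl i) (incl a t) * ((logCoeff t q)⁻¹ * v t))
        (𝓝[reg c r a] p) (𝓝 (∑ t, N (Sum.inl i) (incl a t) * ((logCoeff t p)⁻¹ * v t))) := by
      refine tendsto_finsetSum _ fun t _ => Tendsto.const_mul _ ?_
      -- The term singular along `D_i` drops out because `v` is tangent to `D_i`.
      by_cases ht : t = Sum.inl i
      · subst ht
        simp only [hv, mul_zero]
        exact tendsto_const_nhds
      · have hne : logCoeff t p ≠ 0 := by
          rcases t with k | j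
          · exact hp.2.2 k fun h => ht (by rw [h])
          · exact one_ne_zero
        exact (((continuous_logCoeff t).continuousAt.inv₀ hne).mul
          continuousAt_const).tendsto.mono_left nhdsWithin_le_nhds
    refine h1.congr' ?_
    filter_upwards [self_mem_nhdsWithin] with q hq
    have hqi := ((mem_reg c r a q).1 hq).2 i
    change _ = q (Sum.inl i) * toricForm N a q ![ev (Sum.inl i), v]
    rw [toricForm_ev hN.skew, ← mul_assoc]
    simp only [logCoeff, Sum.elim_inl]
    rw [mul_inv_cancel₀ hqi, one_mul]
    rfl
  · intro p _ _ _
    refine tendsto_const_nhds.congr' ?_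
    filter_upwards [self_mem_nhdsWithin] with q hq
    have hqj : q (Sum.inl j) ≠ 0 := hq.2.2 j hij.symm
    rw [happ, Finset.sum_eq_single (Sum.inl j)]
    · simp only [ev, Pi.single_eq_same, logCoeff, Sum.elim_inl, Matrix.of_apply]
      field_simp
      rfl
    · intro t _ ht
      simp [ev, ht]
    · simp

/-- The logarithmic matrix is constant, so `f ω` has polynomial coefficients, and `f` times the
coefficient of `ωᵏ` is the constant `2⁻ᵏ` times the `pfSum` of a minor of `N`. That minor is
nonsingular by `IsToricMatrix.minor_injective`. -/
theorem isLogSymplectic_toricTwoForm (hN : IsToricMatrix N) (heven : Even (n - 1 + m)) :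
    IsLogSymplectic (toricTwoForm hN c r) where
  closed a p hp := extDeriv_toricForm hp
  simplePole a := by
    refine ⟨fun p => ∑ s, ∑ t, (N (incl a s) (incl a t) / 2 * cofactor s t p) • coordWedge s t,
      fun p _ => ?_, fun p hp => ?_⟩
    · exact Finset.analyticAt_fun_sum _ fun s _ => Finset.analyticAt_fun_sum _ fun t _ =>
        (analyticAt_const.mul (analyticAt_cofactor s t p)).smul analyticAt_const
    · change localEq a p • toricForm N a p = _
      rw [toricForm, Finset.smul_sum]
      refine Finset.sum_congr rfl fun s _ => ?_
      rw [Finset.smul_sum]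
      refine Finset.sum_congr rfl fun t _ => ?_
      -- On the diagonal the cofactor omits only one factor, so the general identity fails, but `ds
      -- ∧ ds = 0`.
      by_cases hst : s = t
      · subst hst
        ext v
        change localEq a p * (_ * coordWedge s s v) = _ * coordWedge s s v
        rw [coordWedge_self, show (0 : Coord n m a [⋀^Fin 2]→L[ℂ] ℂ) v = 0 from rfl]
        simp
      · rw [smul_smul, ← logCoeff_mul_cofactor hst]
        have h1 := logCoeff_ne_zero hp s
        have h2 := logCoeff_ne_zero hp t
        congr 1
        field_simp
  pfaffian := by
    obtain ⟨k, hk⟩ := heven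
    refine ⟨k, by omega, fun a e => ?_⟩
    let M : Matrix (Fin k × Fin 2) (Fin k × Fin 2) ℂ :=
      Matrix.of fun x y => N (incl a (e x)) (incl a (e y))
    refine ⟨fun _ => (2 ^ k : ℂ)⁻¹ * pfSum M, fun _ _ => analyticAt_const, fun _ _ => ?_,
      fun p hp => ?_⟩
    · refine mul_ne_zero (by simp) (pfSum_ne_zero ?_ fun w hw => ?_)
      · ext x y
        exact congrFun (congrFun hN.skew _) _
      · have h : (N.submatrix (incl a) (incl a)).mulVec (w ∘ e.symm) = 0 := by
          funext s
          have h1 := congrFun hw (e.symm s)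
          refine Eq.trans ?_ h1
          simp only [Matrix.mulVec, dotProduct, M, Matrix.of_apply, Equiv.apply_symm_apply,
            Matrix.submatrix_apply, Function.comp_apply]
          rw [← e.sum_comp]
          simp
        have h2 := hN.minor_injective a _ h
        funext x
        have := congrFun h2 (e x)
        simpa using this
    · rw [localEq_mul_wedgePow]
      congr 2
      ext x y
      change logCoeff (e x) p * logCoeff (e y) p * toricForm N a p ![ev (e x), ev (e y)] = _
      rw [toricForm_ev_ev hN.skew]
      have h1 := logCoeff_ne_zero hp (e x)
      have h2 := logCoeff_ne_zero hp (e y)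
      simp only [M, Matrix.of_apply]
      field_simp

end Toric

end

end LogSymp

/-! ### The theorem -/

theorem mainTheorem7 (n m : ℕ) (hn : 3 ≤ n) (c : Fin m → ℂ) (r : Fin m → ℝ)
    (hr : ∀ j, 0 < r j) (B : Matrix (Fin n) (Fin n) ℂ) (hskew : B.transpose = -B)
    (hrow : ∀ i, ∑ j, B i j = 0) :
    ((∃ ω : LogSymp.TwoForm n c r, LogSymp.IsLogSymplectic ω ∧ LogSymp.HasBiresidues ω B) ↔
        (Even (n - 1 + m) ∧ (n : ℤ) - 1 - m ≤ B.rank)) ∧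
      (Even (n - 1 + m) ∧ (n : ℤ) - 1 - m ≤ B.rank →
        ∃ ω : LogSymp.TwoForm n c r, LogSymp.IsLogSymplectic ω ∧ LogSymp.HasBiresidues ω B ∧
          LogSymp.IsSemiToric ω) := by
  have hexists : Even (n - 1 + m) ∧ (n : ℤ) - 1 - m ≤ B.rank →
      ∃ ω : LogSymp.TwoForm n c r, LogSymp.IsLogSymplectic ω ∧ LogSymp.HasBiresidues ω B ∧
        LogSymp.IsSemiToric ω := by
    rintro ⟨heven, hrank⟩
    obtain ⟨N, hN, hNB⟩ := LogSymp.exists_toricMatrix (by omega) hskew hrow heven hrank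
    have hB : (Matrix.of fun i j => N (Sum.inl i) (Sum.inl j)) = B := Matrix.ext hNB
    exact ⟨LogSymp.toricTwoForm hN c r, LogSymp.isLogSymplectic_toricTwoForm hN heven,
      hB ▸ LogSymp.hasBiresidues_toricTwoForm hN, LogSymp.isSemiToric_toricTwoForm hN⟩
  refine ⟨⟨?_, fun h => ?_⟩, hexists⟩
  · rintro ⟨ω, hω, hB⟩
    obtain ⟨k, hk, -⟩ := hω.pfaffian
    have := LogSymp.rank_le_of_isLogSymplectic (by omega) hr hskew hω hB
    exact ⟨⟨k, by omega⟩, by omega⟩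
  · obtain ⟨ω, h1, h2, -⟩ := hexists h
    exact ⟨ω, h1, h2⟩
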